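/- Let $k,m\ge 1$ and let $M_k$ be the set of complex $k\times k$ matrices; identify $M_k\otimes M_m$ with $M_{km}$ by the Kronecker product. Let $A=\sum_{i=1}^n A_i\otimes B_i\in M_k\otimes M_m$ be a positive semidefinite Hermitian matrix, where $A_i\in M_k$, $B_i\in M_m$, and let $$G_A(X)=\sum_{i=1}^n B_i\,\mathrm{tr}(A_iX)\quad(X\in M_k),\qquad F_A(X)=\sum_{i=1}^n A_i\,\mathrm{tr}(B_iX)\quad(X\in M_m).$$ Suppose that $G_A(\mathrm{Id})\in M_m$ and $F_A(\mathrm{Id})\in M_k$ are positive definite. Definitions. A square matrix $(c_{ij})$ of order $d$ has total support if for every $c_{i_0j_0}\ne 0$ there is a permutation $\sigma$ of $\{1,\dots,d\}$ with $\sigma(i_0)=j_0$ and $\prod_{i=1}^d c_{i\sigma(i)}\neq 0$. A $k\times m$ matrix $C$ has total support if the square matrix $C\otimes 1_{m\times k}$ of order $km$ has total support, where $1_{m\times k}$ is the all-ones matrix. A linear map $T:M_k\to M_m$ has total support if for all orthonormal bases $v_1,\dots,v_k$ of $\mathbb C^k$ and $w_1,\dots,w_m$ of $\mathbb C^m$ the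 $k\times m$ matrix $\big(\mathrm{tr}(T(v_iv_i^*)\,w_jw_j^*)\big)_{i,j}$ has total support. The map $T$ is positive if it sends positive semidefinite Hermitian matrices to positive semidefinite Hermitian matrices, and it is equivalent to $G_A$ if there are invertible $X''\in M_k$, $Y''\in M_m$ with $T(X)=Y''G_A(X''XX''^*)Y''^*$ for all $X\in M_k$. Theorem. There are invertible matrices $X'\in M_k$, $Y'\in M_m$ and matrices $C_1,\dots,C_n\in M_k$, $D_1,\dots,D_n\in M_m$ such that $$(X'\otimes Y')A(X'\otimes Y')^*=\sum_{i=1}^n C_i\otimes D_i,\qquad C_1=\tfrac{\mathrm{Id}}{\sqrt k},\quad D_1=\tfrac{\mathrm{Id}}{\sqrt m},\qquad \mathrm{tr}(C_iC_j)=\mathrm{tr}(D_iD_j)=0\ \text{ for all } i\ne j,$$ if and only if $G_A$ is equivalent to a positive map with total support. The same equivalence holds if the number of terms in the sum $\sum_i C_i\otimes D_i$ is not required to be $n$ but may be any positive integer. -/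

import Mathlib

open scoped ComplexOrder Kronecker

namespace FilterNormalForm

/-- A matrix with rows `ι` and columns `κ`, where `ι` and `κ` have the same number of elements
(for `ι = κ` this is a square matrix and the `σ` are its permutations), has total support if every
nonzero entry `M i₀ j₀` is a factor of a nonzero product `∏ i, M i (σ i)`. -/
def SquareTotalSupport {ι κ : Type*} [Fintype ι] (M : Matrix ι κ ℂ) : Prop :=
  ∀ i₀ j₀, M i₀ j₀ ≠ 0 → ∃ σ : ι ≃ κ, σ i₀ = j₀ ∧ ∏ i, M i (σ i) ≠ 0

/-- A rectangular matrix `M` of size `k × m` has total support if the Kronecker product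
`M ⊗ 1_{m × k}` with the all-ones matrix, a square matrix of order `k m`, has total support. -/
def RectTotalSupport {k m : ℕ} (M : Matrix (Fin k) (Fin m) ℂ) : Prop :=
  SquareTotalSupport (M ⊗ₖ (Matrix.of fun (_ : Fin m) (_ : Fin k) => (1 : ℂ)))

/-- The rank one matrix `v v^*`. -/
def outer {d : ℕ} (v : EuclideanSpace ℂ (Fin d)) : Matrix (Fin d) (Fin d) ℂ :=
  Matrix.of fun a b => v a * star (v b)

/-- `T` sends positive semidefinite Hermitian matrices to positive semidefinite ones. -/
def IsPositiveMap {k m : ℕ}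
    (T : Matrix (Fin k) (Fin k) ℂ →ₗ[ℂ] Matrix (Fin m) (Fin m) ℂ) : Prop :=
  ∀ X, X.PosSemidef → (T X).PosSemidef

/-- `T : M_k → M_m` has total support if for all orthonormal bases `v` of `ℂ^k` and `w` of `ℂ^m`
the `k × m` matrix `(tr (T (v_i v_i^*) w_j w_j^*))` has total support. -/
def MapTotalSupport {k m : ℕ}
    (T : Matrix (Fin k) (Fin k) ℂ →ₗ[ℂ] Matrix (Fin m) (Fin m) ℂ) : Prop :=
  ∀ (v : OrthonormalBasis (Fin k) ℂ (EuclideanSpace ℂ (Fin k)))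
    (w : OrthonormalBasis (Fin m) ℂ (EuclideanSpace ℂ (Fin m))),
    RectTotalSupport (Matrix.of fun i j => (T (outer (v i)) * outer (w j)).trace)

/-- `T₁` is equivalent to `T`: `T₁(X) = Y' T(X' X X'^*) Y'^*` for some invertible `X'`, `Y'`. -/
def EquivalentMaps {k m : ℕ}
    (T T₁ : Matrix (Fin k) (Fin k) ℂ →ₗ[ℂ] Matrix (Fin m) (Fin m) ℂ) : Prop :=
  ∃ (X' : Matrix (Fin k) (Fin k) ℂ) (Y' : Matrix (Fin m) (Fin m) ℂ), IsUnit X' ∧ IsUnit Y' ∧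
    ∀ X, T₁ X = Y' * T (X' * X * X'.conjTranspose) * Y'.conjTranspose

/-- The map `G_A(X) = ∑ i, tr(A_i X) B_i` from `M_k` to `M_m`. -/
def mapG {n k m : ℕ} (A : Fin n → Matrix (Fin k) (Fin k) ℂ)
    (B : Fin n → Matrix (Fin m) (Fin m) ℂ) :
    Matrix (Fin k) (Fin k) ℂ →ₗ[ℂ] Matrix (Fin m) (Fin m) ℂ where
  toFun X := ∑ i, (A i * X).trace • B i
  map_add' X Y := by
    simp [Matrix.mul_add, add_smul, Finset.sum_add_distrib]
  map_smul' c X := by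
    simp [Finset.smul_sum, mul_smul]

/-- The map `F_A(X) = ∑ i, tr(B_i X) A_i` from `M_m` to `M_k`. -/
def mapF {n k m : ℕ} (A : Fin n → Matrix (Fin k) (Fin k) ℂ)
    (B : Fin n → Matrix (Fin m) (Fin m) ℂ) :
    Matrix (Fin m) (Fin m) ℂ →ₗ[ℂ] Matrix (Fin k) (Fin k) ℂ :=
  mapG B A

/-- `M ∈ M_k ⊗ M_m` is in filter normal form with `n` terms: `M = ∑ i, C_i ⊗ D_i`, the first
`C_i` is `Id/√k`, the first `D_i` is `Id/√m`, and `tr(C_i C_j) = tr(D_i D_j) = 0` for `i ≠ j`. -/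
def IsFilterNormalForm {k m : ℕ} (n : ℕ)
    (M : Matrix (Fin k × Fin m) (Fin k × Fin m) ℂ) : Prop :=
  ∃ (C : Fin n → Matrix (Fin k) (Fin k) ℂ) (D : Fin n → Matrix (Fin m) (Fin m) ℂ),
    M = ∑ i, C i ⊗ₖ D i ∧
    (∃ hn : 0 < n, C ⟨0, hn⟩ = ((Real.sqrt k : ℝ) : ℂ)⁻¹ • 1 ∧
      D ⟨0, hn⟩ = ((Real.sqrt m : ℝ) : ℂ)⁻¹ • 1) ∧
    ∀ i j, i ≠ j → (C i * C j).trace = 0 ∧ (D i * D j).trace = 0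

/-- `M` can be put in filter normal form with `n` terms by some `X' ⊗ Y'`, with `X'` and `Y'`
invertible. -/
def CanBePutInFilterNormalForm {k m : ℕ} (n : ℕ)
    (M : Matrix (Fin k × Fin m) (Fin k × Fin m) ℂ) : Prop :=
  ∃ (X' : Matrix (Fin k) (Fin k) ℂ) (Y' : Matrix (Fin m) (Fin m) ℂ), IsUnit X' ∧ IsUnit Y' ∧
    IsFilterNormalForm n ((X' ⊗ₖ Y') * M * (X' ⊗ₖ Y').conjTranspose)

end FilterNormalForm

namespace FilterNormalForm

open Matrix Filter Topology

/-! In filter normal form every term but the first is traceless, being trace-orthogonal to the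
identity. So the associated map is doubly stochastic up to scale: it sends `1` to `(√k/√m) • 1` and
multiplies traces by `√m/√k`. The coefficient matrix of such a positive map in any pair of
orthonormal bases has constant row sums and constant column sums, and Birkhoff's theorem gives total
support (`squareTotalSupport_of_sums`).

Conversely, let `T` be positive with total support and equivalent to `G_A`. Minimise `|det T(X)|^k /
|det X|^m` over positive definite `X`. Total support keeps the relevant ratios of eigenvalues
bounded along a minimising sequence, and with Hadamard's inequality the infimum is attained
(`exists_scaling_of_tendsto`, `exists_min_det_ratio`). Once the minimiser and its image are moved to
the identity, the first-order condition reads `k tr T(H) = m tr H` (`trace_eq_of_norm_det_pow_le`),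
so the scaled map is doubly stochastic.

For a doubly stochastic map, remove the component along the identity and take a singular value
decomposition on the real space of Hermitian matrices: this is the normal form
(`isFilterNormalForm_of_doublyStochastic`). Its second factors are independent and lie in the span
of the `B i`, so `n` terms suffice and both versions of the equivalence hold. -/

/-! ### The map of a Kronecker sum: independence of the decomposition, conjugation, positivity. -/

theorem mapG_apply {n k m : ℕ} (A : Fin n → Matrix (Fin k) (Fin k) ℂ)
    (B : Fin n → Matrix (Fin m) (Fin m) ℂ) (X : Matrix (Fin k) (Fin k) ℂ) :
    mapG A B X = ∑ i, (A i * X).trace • B i := rfl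

/-- The entries of `mapG A B X` are partial traces of `∑ i, A i ⊗ₖ B i`. -/
theorem mapG_apply_apply {n k m : ℕ} (A : Fin n → Matrix (Fin k) (Fin k) ℂ)
    (B : Fin n → Matrix (Fin m) (Fin m) ℂ) (X : Matrix (Fin k) (Fin k) ℂ) (a b : Fin m) :
    mapG A B X a b = ∑ p, ∑ q, (∑ i, A i ⊗ₖ B i) (p, a) (q, b) * X q p := by
  simp only [mapG_apply, Matrix.sum_apply, Matrix.smul_apply, smul_eq_mul, Matrix.trace,
    Matrix.diag, Matrix.mul_apply, Finset.sum_mul, Matrix.kroneckerMap_apply]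
  rw [Finset.sum_comm]
  refine Finset.sum_congr rfl fun p _ => ?_
  rw [Finset.sum_comm]
  refine Finset.sum_congr rfl fun q _ => Finset.sum_congr rfl fun i _ => by ring

theorem mapG_congr {n N k m : ℕ} {A : Fin n → Matrix (Fin k) (Fin k) ℂ}
    {B : Fin n → Matrix (Fin m) (Fin m) ℂ} {C : Fin N → Matrix (Fin k) (Fin k) ℂ}
    {D : Fin N → Matrix (Fin m) (Fin m) ℂ} (h : ∑ i, A i ⊗ₖ B i = ∑ i, C i ⊗ₖ D i) :
    mapG A B = mapG C D := by
  ext X a b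
  simp only [mapG_apply_apply, h]

theorem kronecker_conj_sum {n k m : ℕ} (A : Fin n → Matrix (Fin k) (Fin k) ℂ)
    (B : Fin n → Matrix (Fin m) (Fin m) ℂ) (X : Matrix (Fin k) (Fin k) ℂ)
    (Y : Matrix (Fin m) (Fin m) ℂ) :
    (X ⊗ₖ Y) * (∑ i, A i ⊗ₖ B i) * (X ⊗ₖ Y)ᴴ = ∑ i, (X * A i * Xᴴ) ⊗ₖ (Y * B i * Yᴴ) := by
  simp only [Finset.mul_sum, Finset.sum_mul, Matrix.conjTranspose_kronecker,
    Matrix.mul_kronecker_mul]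

theorem mapG_conj {n k m : ℕ} (A : Fin n → Matrix (Fin k) (Fin k) ℂ)
    (B : Fin n → Matrix (Fin m) (Fin m) ℂ) (X Z : Matrix (Fin k) (Fin k) ℂ)
    (Y : Matrix (Fin m) (Fin m) ℂ) :
    mapG (fun i => X * A i * Xᴴ) (fun i => Y * B i * Yᴴ) Z = Y * mapG A B (Xᴴ * Z * X) * Yᴴ := by
  simp only [mapG_apply, Finset.mul_sum, Finset.sum_mul, Matrix.mul_smul, Matrix.smul_mul]
  refine Finset.sum_congr rfl fun i _ => ?_
  congr 1
  rw [Matrix.mul_assoc, Matrix.mul_assoc, Matrix.trace_mul_comm]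
  simp only [Matrix.mul_assoc]

theorem selector_conj_apply {k m : ℕ} (M : Matrix (Fin k × Fin m) (Fin k × Fin m) ℂ)
    (s : Fin k → ℂ) (a b : Fin m) :
    ((Matrix.of fun (x : Fin k × Fin m) (b : Fin m) => if x.2 = b then s x.1 else 0)ᴴ * M *
      (Matrix.of fun (x : Fin k × Fin m) (b : Fin m) => if x.2 = b then s x.1 else 0)) a b =
      ∑ q, ∑ p, M (p, a) (q, b) * (s q * star (s p)) := by
  simp only [Matrix.mul_apply, Fintype.sum_prod_type, conjTranspose_apply,
    Matrix.of_apply, apply_ite, star_zero, ite_mul, zero_mul, mul_zero,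
    Finset.sum_ite_eq', Finset.mem_univ, if_true, Finset.sum_mul]
  refine Finset.sum_congr rfl fun q _ => Finset.sum_congr rfl fun p _ => by ring

/-- Writing `X = S Sᴴ` splits `X` into rank-one terms `s sᴴ`, one per column of `S`. Each
contributes the compression of `A` by a `km × m` matrix of the form `s ⊗ 1`, up to conjugating
nothing but the left factor, and compressions preserve positivity. -/
theorem mapG_isPositiveMap {n k m : ℕ} {A : Fin n → Matrix (Fin k) (Fin k) ℂ}
    {B : Fin n → Matrix (Fin m) (Fin m) ℂ} (hA : (∑ i, A i ⊗ₖ B i).PosSemidef) :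
    IsPositiveMap (mapG A B) := by
  intro X hX
  obtain ⟨S, rfl⟩ : ∃ S : Matrix (Fin k) (Fin k) ℂ, X = S * Sᴴ := by
    open scoped MatrixOrder in
    obtain ⟨S, hS⟩ := CStarAlgebra.nonneg_iff_eq_mul_star_self.mp (Matrix.nonneg_iff_posSemidef.mpr hX)
    exact ⟨S, hS⟩
  have key : mapG A B (S * Sᴴ) = ∑ c : Fin k,
      (Matrix.of fun (x : Fin k × Fin m) (b : Fin m) => if x.2 = b then S x.1 c else 0)ᴴ *
        (∑ i, A i ⊗ₖ B i) *
      (Matrix.of fun (x : Fin k × Fin m) (b : Fin m) => if x.2 = b then S x.1 c else 0) := by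
    ext a b
    rw [mapG_apply_apply, Matrix.sum_apply,
      Finset.sum_congr rfl fun c _ => selector_conj_apply (∑ i, A i ⊗ₖ B i) (fun p => S p c) a b]
    rw [Finset.sum_comm]
    refine Eq.trans ?_ Finset.sum_comm
    refine Finset.sum_congr rfl fun q _ => ?_
    refine Eq.trans ?_ Finset.sum_comm
    refine Finset.sum_congr rfl fun p _ => ?_
    rw [Matrix.mul_apply, Finset.mul_sum]
    rfl
  rw [key]
  exact Matrix.posSemidef_sum _ fun c _ => hA.conjTranspose_mul_mul_same _

/-! ### From filter normal form to total support. -/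

/-- Birkhoff: after division by `s` the matrix is a convex combination of permutation matrices. A
nonzero entry is hit by a permutation of positive weight, and every entry on that permutation is
then positive. -/
theorem squareTotalSupport_of_sums {ι κ : Type*} [Fintype ι] [Fintype κ]
    (e : ι ≃ κ) (M : Matrix ι κ ℝ) {s : ℝ} (hs : 0 < s) (h0 : ∀ i j, 0 ≤ M i j)
    (hr : ∀ i, ∑ j, M i j = s) (hc : ∀ j, ∑ i, M i j = s) :
    SquareTotalSupport (M.map (Complex.ofReal)) := by
  classical
  intro i₀ j₀ hne
  have hD : (Matrix.of fun i j => s⁻¹ * M i (e j)) ∈ doublyStochastic ℝ ι := by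
    rw [mem_doublyStochastic_iff_sum]
    refine ⟨fun i j => ?_, fun i => ?_, fun j => ?_⟩
    · exact mul_nonneg (by positivity) (h0 _ _)
    · simp only [Matrix.of_apply, ← Finset.mul_sum]
      rw [Equiv.sum_comp e (fun j => M i j), hr, inv_mul_cancel₀ hs.ne']
    · simp only [Matrix.of_apply, ← Finset.mul_sum]
      rw [hc, inv_mul_cancel₀ hs.ne']
  obtain ⟨w, hw0, -, hw⟩ := exists_eq_sum_perm_of_mem_doublyStochastic hD
  have hent : ∀ i j, s⁻¹ * M i (e j) = ∑ σ : Equiv.Perm ι, w σ * (if σ i = j then 1 else 0) := by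
    intro i j
    have := congrFun (congrFun hw i) j
    rw [Matrix.of_apply] at this
    rw [← this]
    simp [Matrix.sum_apply, Equiv.Perm.permMatrix, PEquiv.toMatrix_apply, eq_comm]
  have hne' : M i₀ j₀ ≠ 0 := by simpa using hne
  have h1 : ∑ σ : Equiv.Perm ι, w σ * (if σ i₀ = e.symm j₀ then 1 else 0) ≠ 0 := by
    rw [← hent]; simpa [hs.ne'] using hne'
  obtain ⟨σ, -, hσ⟩ := Finset.exists_ne_zero_of_sum_ne_zero h1
  have hσ1 : σ i₀ = e.symm j₀ := by by_contra h; simp [h] at hσ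
  have hwσ : 0 < w σ := lt_of_le_of_ne (hw0 σ) (fun h => hσ (by simp [← h]))
  refine ⟨σ.trans e, by simp [hσ1], Finset.prod_ne_zero_iff.mpr fun i _ => ?_⟩
  have : 0 < s⁻¹ * M i (e (σ i)) := by
    rw [hent]
    refine lt_of_lt_of_le ?_ (Finset.single_le_sum (f := fun τ : Equiv.Perm ι =>
      w τ * (if τ i = σ i then 1 else 0)) (fun τ _ => ?_) (Finset.mem_univ σ))
    · simpa using hwσ
    · have := hw0 τ
      split_ifs <;> simp [this]
  have h2 : M i (e (σ i)) ≠ 0 := fun h => by simp [h] at this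
  simpa using h2

theorem outer_eq {d : ℕ} (v : EuclideanSpace ℂ (Fin d)) :
    outer v = vecMulVec v (star ⇑v) := rfl

theorem outer_posSemidef {d : ℕ} (v : EuclideanSpace ℂ (Fin d)) : (outer v).PosSemidef :=
  Matrix.posSemidef_vecMulVec_self_star _

theorem trace_mul_outer {d : ℕ} (X : Matrix (Fin d) (Fin d) ℂ) (v : EuclideanSpace ℂ (Fin d)) :
    (X * outer v).trace = star ⇑v ⬝ᵥ (X *ᵥ ⇑v) := by
  rw [outer_eq, Matrix.mul_vecMulVec, Matrix.trace_vecMulVec, dotProduct_comm]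

theorem trace_outer {d : ℕ} (v : EuclideanSpace ℂ (Fin d)) (hv : ‖v‖ = 1) :
    (outer v).trace = 1 := by
  have h := trace_mul_outer 1 v
  rw [Matrix.one_mul, Matrix.one_mulVec] at h
  rw [h]
  have h2 : inner ℂ v v = (1 : ℂ) := by simp [inner_self_eq_norm_sq_to_K, hv]
  rw [← h2, EuclideanSpace.inner_eq_star_dotProduct, dotProduct_comm]

theorem sum_outer {d : ℕ} (v : OrthonormalBasis (Fin d) ℂ (EuclideanSpace ℂ (Fin d))) :
    ∑ i, outer (v i) = 1 := by
  ext a b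
  have h := v.sum_inner_mul_inner (EuclideanSpace.single a 1) (EuclideanSpace.single b 1)
  simp [EuclideanSpace.inner_single_left, EuclideanSpace.inner_single_right] at h
  simpa [Matrix.sum_apply, outer, Matrix.one_apply, eq_comm] using h

theorem mapTotalSupport_of_doublyStochastic {k m : ℕ} (hm : 0 < m)
    {T : Matrix (Fin k) (Fin k) ℂ →ₗ[ℂ] Matrix (Fin m) (Fin m) ℂ} (hT : IsPositiveMap T)
    {α β : ℝ} (hα : 0 < α) (h1 : T 1 = (α : ℂ) • 1)
    (htr : ∀ Z, (T Z).trace = (β : ℂ) * Z.trace) : MapTotalSupport T := by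
  intro v w
  -- Both sides compute `tr T(1)`. This makes the row sums `kβ` and column sums `mα` agree after
  -- tensoring with the all-ones matrix.
  have hab : (k : ℝ) * β = m * α := by
    have h := htr 1
    rw [h1] at h
    simp only [Matrix.trace_smul, Matrix.trace_one, Fintype.card_fin, smul_eq_mul] at h
    have h' : ((m * α : ℝ) : ℂ) = ((k * β : ℝ) : ℂ) := by push_cast; linear_combination h
    exact_mod_cast h'.symm
  have hnn : ∀ i j, 0 ≤ (T (outer (v i)) * outer (w j)).trace := by
    intro i j
    rw [trace_mul_outer]
    exact (hT _ (outer_posSemidef _)).dotProduct_mulVec_nonneg _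
  set t : Fin k → Fin m → ℝ := fun i j => (T (outer (v i)) * outer (w j)).trace.re with ht
  have htc : ∀ i j, (T (outer (v i)) * outer (w j)).trace = (t i j : ℂ) := fun i j =>
    Complex.ext rfl (by simpa using (Complex.nonneg_iff.mp (hnn i j)).2.symm)
  have hrow : ∀ i, ∑ j, t i j = β := by
    intro i
    have : ((∑ j, t i j : ℝ) : ℂ) = β := by
      push_cast
      simp only [← htc]
      rw [← Matrix.trace_sum, ← Finset.mul_sum, sum_outer, mul_one, htr,
        trace_outer _ (v.orthonormal.1 i), mul_one]
    exact_mod_cast this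
  have hcol : ∀ j, ∑ i, t i j = α := by
    intro j
    have : ((∑ i, t i j : ℝ) : ℂ) = α := by
      push_cast
      simp only [← htc]
      rw [← Matrix.trace_sum, ← Finset.sum_mul, ← map_sum, sum_outer, h1]
      simp [trace_outer _ (w.orthonormal.1 j)]
    exact_mod_cast this
  have hmk : (0 : ℝ) < m * α := by positivity
  have := squareTotalSupport_of_sums (Equiv.prodComm (Fin k) (Fin m))
    (M := Matrix.of fun (x : Fin k × Fin m) (y : Fin m × Fin k) => t x.1 y.1) hmk
    (fun x y => (Complex.nonneg_iff.mp (hnn _ _)).1)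
    (fun x => by
      simp only [Matrix.of_apply, Fintype.sum_prod_type, Finset.sum_const, Finset.card_univ,
        Fintype.card_fin, nsmul_eq_mul, ← Finset.mul_sum, hrow, hab])
    (fun y => by
      simp only [Matrix.of_apply, Fintype.sum_prod_type, Finset.sum_const, Finset.card_univ,
        Fintype.card_fin, nsmul_eq_mul, ← Finset.mul_sum, hcol])
  unfold RectTotalSupport
  convert this using 1
  ext x y
  simp [htc, Matrix.kroneckerMap_apply]

theorem exists_totalSupport_of_filterNormalForm {n N k m : ℕ} (hk : 0 < k) (hm : 0 < m)
    {A : Fin n → Matrix (Fin k) (Fin k) ℂ} {B : Fin n → Matrix (Fin m) (Fin m) ℂ}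
    (hA : (∑ i, A i ⊗ₖ B i).PosSemidef)
    (h : CanBePutInFilterNormalForm N (∑ i, A i ⊗ₖ B i)) :
    ∃ T : Matrix (Fin k) (Fin k) ℂ →ₗ[ℂ] Matrix (Fin m) (Fin m) ℂ,
      IsPositiveMap T ∧ EquivalentMaps (mapG A B) T ∧ MapTotalSupport T := by
  obtain ⟨X, Y, hX, hY, C, D, hCD, ⟨hN, hC, hD⟩, horth⟩ := h
  have hkk : ((Real.sqrt k : ℝ) : ℂ) ≠ 0 := by
    simpa using (Real.sqrt_pos.mpr (Nat.cast_pos.mpr hk)).ne'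
  have hmm : ((Real.sqrt m : ℝ) : ℂ) ≠ 0 := by
    simpa using (Real.sqrt_pos.mpr (Nat.cast_pos.mpr hm)).ne'
  have hk2 : ((Real.sqrt k : ℝ) : ℂ) * (Real.sqrt k : ℝ) = k := by
    rw [← Complex.ofReal_mul, Real.mul_self_sqrt (Nat.cast_nonneg k)]; simp
  have hm2 : ((Real.sqrt m : ℝ) : ℂ) * (Real.sqrt m : ℝ) = m := by
    rw [← Complex.ofReal_mul, Real.mul_self_sqrt (Nat.cast_nonneg m)]; simp
  have hconj := kronecker_conj_sum A B X Y
  have hpsd : (∑ i, C i ⊗ₖ D i).PosSemidef := by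
    rw [← hCD]; exact hA.mul_mul_conjTranspose_same _
  have hpos := mapG_isPositiveMap hpsd
  have htrC : ∀ i, i ≠ ⟨0, hN⟩ → (C i).trace = 0 := by
    intro i hi
    have := (horth i _ hi).1
    rw [hC] at this
    simpa [hkk] using this
  have htrD : ∀ i, i ≠ ⟨0, hN⟩ → (D i).trace = 0 := by
    intro i hi
    have := (horth i _ hi).2
    rw [hD] at this
    simpa [hmm] using this
  refine ⟨mapG C D, hpos, ⟨Xᴴ, Y, ?_, hY, fun Z => ?_⟩, ?_⟩
  · rw [← Matrix.star_eq_conjTranspose]; exact hX.star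
  · rw [← mapG_congr (hconj.symm.trans hCD), mapG_conj, Matrix.conjTranspose_conjTranspose]
  · refine mapTotalSupport_of_doublyStochastic hm hpos (α := Real.sqrt k / Real.sqrt m)
      (β := Real.sqrt m / Real.sqrt k) (by positivity) ?_ fun Z => ?_
    · rw [mapG_apply, Finset.sum_eq_single ⟨0, hN⟩]
      · rw [hC, hD, mul_one, Matrix.trace_smul, Matrix.trace_one, smul_smul, Fintype.card_fin]
        congr 1
        push_cast
        rw [← hk2, smul_eq_mul]
        field_simp
      · intro i _ hi
        rw [mul_one, htrC i hi, zero_smul]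
      · simp
    · rw [mapG_apply, Matrix.trace_sum, Finset.sum_eq_single ⟨0, hN⟩]
      · rw [hC, hD, Matrix.trace_smul, Matrix.trace_smul, Matrix.trace_one, Matrix.smul_mul,
          Matrix.trace_smul, Matrix.one_mul, Fintype.card_fin, ← hm2]
        push_cast
        simp only [smul_eq_mul]
        field_simp
      · intro i _ hi
        rw [Matrix.trace_smul, htrD i hi, smul_zero]
      · simp

/-! ### Real coordinates on Hermitian matrices and singular vectors. -/

/-- Hermitian matrices in real coordinates: an isometry from real `k × k` matrices, with the
Euclidean inner product, onto the Hermitian matrices with the inner product `tr (X Y)`. -/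
noncomputable def hermOf (k : ℕ) :
    EuclideanSpace ℝ (Fin k × Fin k) →ₗ[ℝ] Matrix (Fin k) (Fin k) ℂ where
  toFun S := Matrix.of fun a b =>
    ((1 + Complex.I) / 2) * (S (a, b) : ℂ) + ((1 - Complex.I) / 2) * (S (b, a) : ℂ)
  map_add' S R := by
    ext a b
    simp
    ring
  map_smul' c S := by
    ext a b
    simp
    ring

/-- The inverse of `hermOf` on Hermitian matrices. -/
noncomputable def hermCoord (k : ℕ) :
    Matrix (Fin k) (Fin k) ℂ →ₗ[ℝ] EuclideanSpace ℝ (Fin k × Fin k) where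
  toFun X := WithLp.toLp 2 fun p => (X p.1 p.2).re + (X p.1 p.2).im
  map_add' X Y := by
    ext p
    simp
    ring
  map_smul' c X := by
    ext p
    simp
    ring

theorem hermOf_apply {k : ℕ} (S : EuclideanSpace ℝ (Fin k × Fin k)) (a b : Fin k) :
    hermOf k S a b =
      ((1 + Complex.I) / 2) * (S (a, b) : ℂ) + ((1 - Complex.I) / 2) * (S (b, a) : ℂ) := rfl

theorem hermOf_isHermitian {k : ℕ} (S : EuclideanSpace ℝ (Fin k × Fin k)) :
    (hermOf k S).IsHermitian := by
  ext a b
  rw [conjTranspose_apply, hermOf_apply, hermOf_apply]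
  simp [Complex.ext_iff]
  constructor <;> ring

theorem hermOf_hermCoord {k : ℕ} {X : Matrix (Fin k) (Fin k) ℂ} (hX : X.IsHermitian) :
    hermOf k (hermCoord k X) = X := by
  ext a b
  have h := hX.apply a b
  rw [hermOf_apply]
  have h1 : (X b a).re = (X a b).re := by rw [← h]; simp
  have h2 : (X b a).im = -(X a b).im := by rw [← h]; simp
  simp [hermCoord, h1, h2, Complex.ext_iff]
  constructor <;> ring

theorem trace_hermOf_mul {k : ℕ} (S R : EuclideanSpace ℝ (Fin k × Fin k)) :
    (hermOf k S * hermOf k R).trace = ((inner ℝ S R : ℝ) : ℂ) := by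
  have hI : Complex.I * Complex.I = -1 := Complex.I_mul_I
  have h1 : ∀ a b : Fin k, hermOf k S a b * hermOf k R b a =
      (S (a, b) * R (a, b) + S (b, a) * R (b, a) : ℂ) / 2 +
        (Complex.I / 2) * (S (a, b) * R (b, a) - S (b, a) * R (a, b) : ℂ) := by
    intro a b
    rw [hermOf_apply, hermOf_apply]
    linear_combination ((S (a, b) : ℂ) * R (b, a) - S (a, b) * R (a, b) - S (b, a) * R (b, a) +
      S (b, a) * R (a, b)) / 4 * hI
  have hs : ∀ f : Fin k → Fin k → ℂ, ∑ a, ∑ b, f b a = ∑ a, ∑ b, f a b := fun f =>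
    Finset.sum_comm
  simp only [Matrix.trace, Matrix.diag, Matrix.mul_apply, h1, Finset.sum_add_distrib,
    ← Finset.mul_sum, ← Finset.sum_div, Finset.sum_sub_distrib]
  rw [hs fun a b => (S (a, b) * R (a, b) : ℂ), hs fun a b => (S (a, b) * R (b, a) : ℂ)]
  simp only [PiLp.inner_apply, Fintype.sum_prod_type, RCLike.inner_apply, conj_trivial]
  push_cast
  simp only [mul_comm]
  ring

/-- Singular value decomposition: `b` is an eigenbasis of `L* L`. Leaving `x` arbitrary gives both
orthogonality of the images and, for `x` in the kernel, that a `b i` with nonzero image is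
orthogonal to `x`. -/
theorem exists_orthonormalBasis_inner_map {E F : Type*} [NormedAddCommGroup E]
    [InnerProductSpace ℝ E] [FiniteDimensional ℝ E] [NormedAddCommGroup F]
    [InnerProductSpace ℝ F] [FiniteDimensional ℝ F] (L : E →ₗ[ℝ] F) :
    ∃ b : OrthonormalBasis (Fin (Module.finrank ℝ E)) ℝ E,
      ∀ i x, inner ℝ (L (b i)) (L x) = ‖L (b i)‖ ^ 2 * inner ℝ (b i) x := by
  have hS : (L.adjoint ∘ₗ L).IsSymmetric := fun x y => by
    simp [LinearMap.adjoint_inner_left, LinearMap.adjoint_inner_right]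
  have key : ∀ i x, inner ℝ (L (hS.eigenvectorBasis rfl i)) (L x) =
      hS.eigenvalues rfl i * inner ℝ (hS.eigenvectorBasis rfl i) x := by
    intro i x
    have h := hS.apply_eigenvectorBasis rfl i
    rw [← LinearMap.adjoint_inner_left, ← LinearMap.comp_apply, h, inner_smul_left]
    simp
  refine ⟨hS.eigenvectorBasis rfl, fun i x => ?_⟩
  have hi := key i (hS.eigenvectorBasis rfl i)
  rw [real_inner_self_eq_norm_sq, real_inner_self_eq_norm_sq,
    (hS.eigenvectorBasis rfl).orthonormal.1 i, one_pow, mul_one] at hi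
  rw [hi, key]

/-- For Hermitian `Z` this is the expansion in a real orthonormal basis; the real and imaginary
parts of `Z` extend it complex-linearly. -/
theorem sum_trace_smul_hermOf {k : ℕ} {ι : Type*} [Fintype ι]
    (b : OrthonormalBasis ι ℝ (EuclideanSpace ℝ (Fin k × Fin k)))
    (Z : Matrix (Fin k) (Fin k) ℂ) :
    Z = ∑ i, (hermOf k (b i) * Z).trace • hermOf k (b i) := by
  have herm : ∀ Z : Matrix (Fin k) (Fin k) ℂ, Z.IsHermitian →
      Z = ∑ i, (hermOf k (b i) * Z).trace • hermOf k (b i) := by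
    intro Z hZ
    conv_lhs => rw [← hermOf_hermCoord hZ, ← b.sum_repr' (hermCoord k Z), map_sum]
    refine Finset.sum_congr rfl fun i _ => ?_
    conv_rhs => rw [← hermOf_hermCoord hZ, trace_hermOf_mul]
    rw [map_smul, Complex.coe_smul]
  have h1 := herm _ (realPart Z).2
  have h2 := herm _ (imaginaryPart Z).2
  have h3 := realPart_add_I_smul_imaginaryPart Z
  conv_lhs => rw [← h3, h1, h2, Finset.smul_sum, ← Finset.sum_add_distrib]
  refine Finset.sum_congr rfl fun i _ => ?_
  conv_rhs => rw [← h3]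
  rw [Matrix.mul_add, Matrix.trace_add, Matrix.mul_smul, Matrix.trace_smul, add_smul, smul_eq_mul,
    mul_smul]

theorem kronecker_sum_eq_sum_hermOf {n k m : ℕ} {ι : Type*} [Fintype ι]
    (A : Fin n → Matrix (Fin k) (Fin k) ℂ) (B : Fin n → Matrix (Fin m) (Fin m) ℂ)
    (b : OrthonormalBasis ι ℝ (EuclideanSpace ℝ (Fin k × Fin k))) :
    ∑ i, A i ⊗ₖ B i = ∑ j, hermOf k (b j) ⊗ₖ mapG A B (hermOf k (b j)) := by
  have hB : ∀ j, hermOf k (b j) ⊗ₖ mapG A B (hermOf k (b j)) =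
      ∑ i, ((hermOf k (b j) * A i).trace • hermOf k (b j)) ⊗ₖ B i := by
    intro j
    ext x y
    simp only [mapG_apply, Matrix.kroneckerMap_apply, Matrix.sum_apply, Matrix.smul_apply,
      smul_eq_mul, Finset.mul_sum]
    refine Finset.sum_congr rfl fun i _ => ?_
    rw [Matrix.trace_mul_comm (A i)]
    ring
  simp only [hB]
  rw [Finset.sum_comm]
  refine Finset.sum_congr rfl fun i _ => ?_
  conv_lhs => rw [sum_trace_smul_hermOf b (A i)]
  ext x y
  simp only [Matrix.kroneckerMap_apply, Matrix.sum_apply, Finset.sum_mul]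

theorem mapG_isHermitian {n k m : ℕ} {A : Fin n → Matrix (Fin k) (Fin k) ℂ}
    {B : Fin n → Matrix (Fin m) (Fin m) ℂ} (hA : (∑ i, A i ⊗ₖ B i).IsHermitian)
    {Z : Matrix (Fin k) (Fin k) ℂ} (hZ : Z.IsHermitian) : (mapG A B Z).IsHermitian := by
  ext a b
  rw [conjTranspose_apply, mapG_apply_apply, mapG_apply_apply, star_sum, Finset.sum_comm]
  simp only [star_sum, star_mul']
  rw [Finset.sum_comm]
  conv_rhs => rw [Finset.sum_comm]
  refine Finset.sum_congr rfl fun q _ => Finset.sum_congr rfl fun p _ => ?_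
  rw [hA.apply, hZ.apply]

/-! ### Doubly stochastic maps give filter normal forms with at most `n` nonzero terms. -/

/-- Padding by zero terms affects neither the sum nor orthogonality; a transposition puts the
distinguished index in position `0`. -/
theorem isFilterNormalForm_of_family {k m n : ℕ} {ι : Type*} [Fintype ι]
    {M : Matrix (Fin k × Fin m) (Fin k × Fin m) ℂ}
    (C : ι → Matrix (Fin k) (Fin k) ℂ) (D : ι → Matrix (Fin m) (Fin m) ℂ) (i₀ : ι)
    (hn : Fintype.card ι ≤ n) (hM : M = ∑ i, C i ⊗ₖ D i)
    (hC : C i₀ = ((Real.sqrt k : ℝ) : ℂ)⁻¹ • 1) (hD : D i₀ = ((Real.sqrt m : ℝ) : ℂ)⁻¹ • 1)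
    (horth : ∀ i j, i ≠ j → (C i * C j).trace = 0 ∧ (D i * D j).trace = 0) :
    IsFilterNormalForm n M := by
  classical
  have hn0 : 0 < n := lt_of_lt_of_le (Fintype.card_pos_iff.mpr ⟨i₀⟩) hn
  obtain ⟨f⟩ : Nonempty (ι ↪ Fin n) := Function.Embedding.nonempty_of_card_le (by simpa using hn)
  obtain ⟨e, he⟩ : ∃ e : ι ↪ Fin n, e i₀ = ⟨0, hn0⟩ :=
    ⟨f.trans (Equiv.swap (f i₀) ⟨0, hn0⟩).toEmbedding, by simp⟩
  refine ⟨Function.extend e C 0, Function.extend e D 0, ?_, ⟨hn0, ?_, ?_⟩, ?_⟩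
  · rw [hM]
    refine Finset.sum_of_injOn e e.injective.injOn (by simp) (fun i _ hi => ?_) fun i _ => ?_
    · rw [Function.extend_apply' _ _ _ (by simpa using hi)]
      simp
    · rw [e.injective.extend_apply, e.injective.extend_apply]
  · rw [← he, e.injective.extend_apply, hC]
  · rw [← he, e.injective.extend_apply, hD]
  · intro i j hij
    by_cases hi : ∃ a, e a = i
    · by_cases hj : ∃ a, e a = j
      · obtain ⟨a, rfl⟩ := hi
        obtain ⟨c, rfl⟩ := hj
        simp only [e.injective.extend_apply]
        exact horth a c fun h => hij (h ▸ rfl)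
      · rw [Function.extend_apply' _ _ _ hj, Function.extend_apply' _ _ _ hj]
        simp
    · rw [Function.extend_apply' _ _ _ hi, Function.extend_apply' _ _ _ hi]
      simp

/-- Pairing a linear relation with `D i` isolates its `i`-th coefficient, so the `D i` are
independent in a span of dimension at most `n`. -/
theorem card_le_of_trace_orthogonal {m n : ℕ} {ι : Type*} [Fintype ι]
    (D : ι → Matrix (Fin m) (Fin m) ℂ) (B : Fin n → Matrix (Fin m) (Fin m) ℂ)
    (hne : ∀ i, (D i * D i).trace ≠ 0) (horth : ∀ i j, i ≠ j → (D i * D j).trace = 0)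
    (hspan : ∀ i, D i ∈ Submodule.span ℂ (Set.range B)) : Fintype.card ι ≤ n := by
  classical
  have hli : LinearIndependent ℂ D := by
    rw [Fintype.linearIndependent_iff]
    intro g hg i
    have h := congrArg (fun X => (D i * X).trace) hg
    simp only [Finset.mul_sum, Matrix.trace_sum, Matrix.mul_smul, Matrix.trace_smul, mul_zero,
      Matrix.trace_zero] at h
    rw [Finset.sum_eq_single i (fun j _ hj => by rw [horth i j hj.symm, smul_zero])
      (by simp)] at h
    exact (smul_eq_zero.mp h).resolve_right (hne i)
  have hli' : LinearIndependent ℂ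
      (fun i => (⟨D i, hspan i⟩ : Submodule.span ℂ (Set.range B))) :=
    LinearIndependent.of_comp (Submodule.span ℂ (Set.range B)).subtype hli
  exact hli'.fintype_card_le_finrank.trans ((finrank_range_le_card B).trans_eq (by simp))

set_option maxHeartbeats 1000000 in
theorem isFilterNormalForm_of_doublyStochastic {n k m : ℕ} (hk : 0 < k) (hm : 0 < m)
    {A : Fin n → Matrix (Fin k) (Fin k) ℂ} {B : Fin n → Matrix (Fin m) (Fin m) ℂ}
    (hA : (∑ i, A i ⊗ₖ B i).IsHermitian)
    (h1 : mapG A B 1 = ((Real.sqrt k / Real.sqrt m : ℝ) : ℂ) • 1)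
    (htr : ∀ Z, (mapG A B Z).trace = ((Real.sqrt m / Real.sqrt k : ℝ) : ℂ) * Z.trace) :
    IsFilterNormalForm n (∑ i, A i ⊗ₖ B i) := by
  classical
  set rk : ℝ := Real.sqrt k with hrk
  set rm : ℝ := Real.sqrt m with hrm
  have hk0 : 0 < rk := Real.sqrt_pos.mpr (Nat.cast_pos.mpr hk)
  have hm0 : 0 < rm := Real.sqrt_pos.mpr (Nat.cast_pos.mpr hm)
  have hkc : (rk : ℂ) ≠ 0 := by exact_mod_cast hk0.ne'
  have hmc : (rm : ℂ) ≠ 0 := by exact_mod_cast hm0.ne'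
  have hk2 : (k : ℂ) = rk * rk := by
    rw [← Complex.ofReal_mul, Real.mul_self_sqrt (Nat.cast_nonneg k)]; simp
  have hm2 : (m : ℂ) = rm * rm := by
    rw [← Complex.ofReal_mul, Real.mul_self_sqrt (Nat.cast_nonneg m)]; simp
  -- `mapG A B` minus the contribution of the first term
  let G : Matrix (Fin k) (Fin k) ℂ →ₗ[ℂ] Matrix (Fin m) (Fin m) ℂ :=
    mapG A B - (((rk * rm : ℝ) : ℂ)⁻¹ • (Matrix.traceLinearMap (Fin k) ℂ ℂ).smulRight 1)
  have hG : ∀ Z, G Z = mapG A B Z - (((rk * rm : ℝ) : ℂ)⁻¹ * Z.trace) • 1 := fun Z => by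
    simp [G, mul_smul]
  have hG1 : G 1 = 0 := by
    rw [hG, h1, ← sub_smul, Matrix.trace_one, Fintype.card_fin, hk2]
    push_cast
    rw [show (rk : ℂ) / rm - ((rk : ℂ) * rm)⁻¹ * (rk * rk) = 0 by field_simp; ring, zero_smul]
  have hGtr : ∀ Z, (G Z).trace = 0 := fun Z => by
    rw [hG, Matrix.trace_sub, htr, Matrix.trace_smul, Matrix.trace_one, Fintype.card_fin, hm2]
    push_cast
    simp only [smul_eq_mul]
    field_simp
    ring
  have hGh : ∀ S, (G (hermOf k S)).IsHermitian := fun S => by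
    rw [hG]
    refine (mapG_isHermitian hA (hermOf_isHermitian S)).sub ?_
    have htrace : star (hermOf k S).trace = (hermOf k S).trace := by
      rw [← Matrix.trace_conjTranspose, (hermOf_isHermitian S).eq]
    rw [Matrix.IsHermitian, Matrix.conjTranspose_smul, Matrix.conjTranspose_one, star_mul',
      htrace]
    simp
  let L : EuclideanSpace ℝ (Fin k × Fin k) →ₗ[ℝ] EuclideanSpace ℝ (Fin m × Fin m) :=
    hermCoord m ∘ₗ (G.restrictScalars ℝ) ∘ₗ hermOf k
  have hL : ∀ S, hermOf m (L S) = G (hermOf k S) := fun S => hermOf_hermCoord (hGh S)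
  obtain ⟨b, hb⟩ := exists_orthonormalBasis_inner_map L
  have hLtr : ∀ S R, (G (hermOf k S) * G (hermOf k R)).trace = ((inner ℝ (L S) (L R) : ℝ) : ℂ) :=
    fun S R => by rw [← hL, ← hL, trace_hermOf_mul]
  have horthL : ∀ i j, i ≠ j → inner ℝ (L (b i)) (L (b j)) = 0 := fun i j hij => by
    rw [hb, b.orthonormal.2 hij, mul_zero]
  -- `G` kills the identity, so singular vectors with nonzero image are orthogonal to it, that is,
  -- traceless.
  have htr0 : ∀ j, L (b j) ≠ 0 → (hermOf k (b j)).trace = 0 := fun j hj => by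
    have h := hb j (hermCoord k 1)
    have h0 : L (hermCoord k 1) = 0 := by
      change hermCoord m (G (hermOf k (hermCoord k 1))) = 0
      rw [hermOf_hermCoord Matrix.isHermitian_one, hG1, map_zero]
    rw [h0, inner_zero_right, eq_comm, mul_eq_zero] at h
    have h' := h.resolve_left (by simpa using hj)
    have h2 := trace_hermOf_mul (b j) (hermCoord k 1)
    rwa [hermOf_hermCoord Matrix.isHermitian_one, mul_one, h', Complex.ofReal_zero] at h2
  have hGmap : ∀ j, L (b j) ≠ 0 → G (hermOf k (b j)) = mapG A B (hermOf k (b j)) := fun j hj => by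
    rw [hG, htr0 j hj]; simp
  have hmem : ∀ Z, mapG A B Z ∈ Submodule.span ℂ (Set.range B) := fun Z => by
    rw [mapG_apply]
    exact Submodule.sum_mem _ fun i _ => Submodule.smul_mem _ _
      (Submodule.subset_span (Set.mem_range_self i))
  have hone : (1 : Matrix (Fin m) (Fin m) ℂ) ∈ Submodule.span ℂ (Set.range B) := by
    have h := Submodule.smul_mem _ (((rk / rm : ℝ) : ℂ)⁻¹) (hmem 1)
    rwa [h1, smul_smul, inv_mul_cancel₀ (by
      exact_mod_cast (div_pos hk0 hm0).ne'), one_smul] at h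
  let J := {j // L (b j) ≠ 0}
  let C : Option J → Matrix (Fin k) (Fin k) ℂ := fun o => o.elim ((rk : ℂ)⁻¹ • 1) fun j =>
    hermOf k (b j)
  let D : Option J → Matrix (Fin m) (Fin m) ℂ := fun o => o.elim ((rm : ℂ)⁻¹ • 1) fun j =>
    G (hermOf k (b j))
  have horth : ∀ i j, i ≠ j → (C i * C j).trace = 0 ∧ (D i * D j).trace = 0 := by
    rintro (_ | i) (_ | j) hij
    · exact absurd rfl hij
    · simp [C, D, htr0 j j.2, hGtr]
    · simp [C, D, htr0 i i.2, hGtr]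
    · have hij' : i.1 ≠ j.1 := fun h => hij (congrArg some (Subtype.ext h))
      refine ⟨?_, ?_⟩
      · change (hermOf k (b i) * hermOf k (b j)).trace = 0
        rw [trace_hermOf_mul, b.orthonormal.2 hij', Complex.ofReal_zero]
      · change (G (hermOf k (b i)) * G (hermOf k (b j))).trace = 0
        rw [hLtr, horthL _ _ hij', Complex.ofReal_zero]
  refine isFilterNormalForm_of_family C D none ?_ ?_ rfl rfl horth
  · refine card_le_of_trace_orthogonal D B ?_ (fun i j hij => (horth i j hij).2) ?_
    · rintro (_ | j)
      · have : (m : ℂ) ≠ 0 := by exact_mod_cast hm.ne'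
        simp [D, hmc, this]
      · change (G (hermOf k (b j)) * G (hermOf k (b j))).trace ≠ 0
        rw [hLtr]
        exact_mod_cast inner_self_ne_zero.mpr j.2
    · rintro (_ | j)
      · exact Submodule.smul_mem _ _ hone
      · change G (hermOf k (b j)) ∈ _
        rw [hGmap j j.2]
        exact hmem _
  · have hsum : ∑ j : J, hermOf k (b j) ⊗ₖ G (hermOf k (b j)) =
        ∑ j, hermOf k (b j) ⊗ₖ G (hermOf k (b j)) := by
      refine Fintype.sum_of_injective (fun j : J => j.1) Subtype.val_injective _ _
        (fun j hj => ?_) fun _ => rfl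
      have hj0 : L (b j) = 0 := by
        by_contra h
        exact hj ⟨⟨j, h⟩, rfl⟩
      rw [← hL, hj0, map_zero, Matrix.kronecker_zero]
    rw [Fintype.sum_option]
    change _ = ((rk : ℂ)⁻¹ • 1) ⊗ₖ ((rm : ℂ)⁻¹ • 1) +
      ∑ j : J, hermOf k (b j) ⊗ₖ G (hermOf k (b j))
    rw [hsum, kronecker_sum_eq_sum_hermOf A B b]
    have hid : (1 : Matrix (Fin k) (Fin k) ℂ) = ∑ j, (hermOf k (b j)).trace • hermOf k (b j) := by
      conv_lhs => rw [sum_trace_smul_hermOf b 1]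
      simp only [mul_one]
    -- Expanding the identity of `M_k` in the basis spreads the first term over all `j`, where it
    -- restores exactly what was subtracted from `mapG A B` to form `G`.
    have hsplit : ((rk : ℂ)⁻¹ • (1 : Matrix (Fin k) (Fin k) ℂ)) ⊗ₖ
        ((rm : ℂ)⁻¹ • (1 : Matrix (Fin m) (Fin m) ℂ)) =
        ∑ j, hermOf k (b j) ⊗ₖ ((((rk * rm : ℝ) : ℂ)⁻¹ * (hermOf k (b j)).trace) •
          (1 : Matrix (Fin m) (Fin m) ℂ)) := by
      conv_lhs => rw [hid]
      ext x y
      simp only [Matrix.kroneckerMap_apply, Matrix.sum_apply, Finset.sum_mul, Matrix.smul_apply,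
        Finset.smul_sum, smul_eq_mul]
      refine Finset.sum_congr rfl fun j _ => ?_
      push_cast
      rw [mul_inv]
      ring
    rw [hsplit, ← Finset.sum_add_distrib]
    refine Finset.sum_congr rfl fun j _ => ?_
    rw [← Matrix.kronecker_add, hG, add_sub_cancel]

/-! ### Determinants of positive definite matrices. -/

theorem posDef_eq_unitary_conj {ι : Type*} [Fintype ι] [DecidableEq ι] {X : Matrix ι ι ℂ}
    (hX : X.PosDef) : ∃ U ∈ Matrix.unitaryGroup ι ℂ, ∃ x : ι → ℝ, (∀ i, 0 < x i) ∧
      X = U * diagonal (fun i => (x i : ℂ)) * Uᴴ := by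
  refine ⟨hX.isHermitian.eigenvectorUnitary, SetLike.coe_mem _, hX.isHermitian.eigenvalues,
    hX.eigenvalues_pos, ?_⟩
  have h := hX.isHermitian.spectral_theorem
  rw [Unitary.conjStarAlgAut_apply] at h
  exact h

theorem det_unitary_conj {ι : Type*} [Fintype ι] [DecidableEq ι] {U : Matrix ι ι ℂ}
    (hU : U ∈ Matrix.unitaryGroup ι ℂ) (D : Matrix ι ι ℂ) : (U * D * Uᴴ).det = D.det := by
  have h : U * Uᴴ = 1 := Matrix.mem_unitaryGroup_iff.mp hU
  rw [Matrix.det_mul, Matrix.det_mul, mul_right_comm, ← Matrix.det_mul, h, Matrix.det_one, one_mul]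

theorem norm_det_unitary_conj_diagonal {ι : Type*} [Fintype ι] [DecidableEq ι] {U : Matrix ι ι ℂ}
    (hU : U ∈ Matrix.unitaryGroup ι ℂ) {x : ι → ℝ} (hx : ∀ i, 0 < x i) :
    ‖(U * diagonal (fun i => (x i : ℂ)) * Uᴴ).det‖ = ∏ i, x i := by
  rw [det_unitary_conj hU, Matrix.det_diagonal, norm_prod]
  exact Finset.prod_congr rfl fun i _ => by simp [abs_of_pos (hx i)]

theorem unitary_conj_diagonal_posDef {ι : Type*} [Fintype ι] [DecidableEq ι] {U : Matrix ι ι ℂ}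
    (hU : U ∈ Matrix.unitaryGroup ι ℂ) {x : ι → ℝ} (hx : ∀ i, 0 < x i) :
    (U * diagonal (fun i => (x i : ℂ)) * Uᴴ).PosDef := by
  have hu : IsUnit U := IsUnit.of_mul_eq_one _ (Matrix.mem_unitaryGroup_iff.mp hU)
  have h := (Matrix.IsUnit.posDef_star_right_conjugate_iff (x := diagonal (fun i => (x i : ℂ))) hu).mpr
    (Matrix.PosDef.diagonal fun i => by exact_mod_cast hx i)
  exact h

/-- Each eigenvalue satisfies `λ ≤ exp (λ - 1)`, and the exponents sum to zero because the trace
equals the order. -/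
theorem norm_det_le_one_of_diag_eq_one {ι : Type*} [Fintype ι] [DecidableEq ι] {X : Matrix ι ι ℂ}
    (hX : X.PosDef) (h1 : ∀ i, X i i = 1) : ‖X.det‖ ≤ 1 := by
  rw [hX.isHermitian.det_eq_prod_eigenvalues, norm_prod]
  have htr : ∑ i, hX.isHermitian.eigenvalues i = Fintype.card ι := by
    have h := hX.isHermitian.trace_eq_sum_eigenvalues
    simp only [Matrix.trace, Matrix.diag, h1, Finset.sum_const, Finset.card_univ, nsmul_eq_mul,
      mul_one] at h
    have h' : ((∑ i, hX.isHermitian.eigenvalues i : ℝ) : ℂ) = ((Fintype.card ι : ℝ) : ℂ) := by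
      simpa using h.symm
    exact_mod_cast h'
  calc ∏ i, ‖(hX.isHermitian.eigenvalues i : ℂ)‖
      ≤ ∏ i, Real.exp (hX.isHermitian.eigenvalues i - 1) := by
        refine Finset.prod_le_prod (fun i _ => norm_nonneg _) fun i _ => ?_
        rw [Complex.norm_real, Real.norm_of_nonneg (hX.eigenvalues_pos i).le]
        linarith [Real.add_one_le_exp (hX.isHermitian.eigenvalues i - 1)]
    _ = 1 := by
        rw [← Real.exp_sum, Finset.sum_sub_distrib, htr]
        simp

/-- **Hadamard's inequality** for positive definite matrices. -/
theorem norm_det_le_prod_diag {ι : Type*} [Fintype ι] [DecidableEq ι] {X : Matrix ι ι ℂ}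
    (hX : X.PosDef) : ‖X.det‖ ≤ ∏ i, (X i i).re := by
  have hd : ∀ i, 0 < (X i i).re := fun i => (Complex.pos_iff.mp (hX.diag_pos (i := i))).1
  have hdc : ∀ i, X i i = ((X i i).re : ℂ) := fun i =>
    Complex.ext rfl (by simpa using (Complex.pos_iff.mp (hX.diag_pos (i := i))).2.symm)
  -- Conjugation by this diagonal matrix makes all diagonal entries `1`.
  set r : ι → ℝ := fun i => (Real.sqrt (X i i).re)⁻¹ with hr
  have hr0 : ∀ i, 0 < r i := fun i => inv_pos.mpr (Real.sqrt_pos.mpr (hd i))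
  have hrr : ∀ i, r i * r i * (X i i).re = 1 := fun i => by
    rw [hr]
    dsimp only
    rw [← mul_inv, Real.mul_self_sqrt (hd i).le, inv_mul_cancel₀ (hd i).ne']
  set S : Matrix ι ι ℂ := diagonal fun i => (r i : ℂ) with hS
  have hSu : IsUnit S := by
    rw [Matrix.isUnit_iff_isUnit_det, hS, Matrix.det_diagonal, isUnit_iff_ne_zero]
    exact Finset.prod_ne_zero_iff.mpr fun i _ => by exact_mod_cast (hr0 i).ne'
  have hSs : star S = S := by
    rw [hS, Matrix.star_eq_conjTranspose, Matrix.diagonal_conjTranspose]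
    congr 1
    ext i
    simp
  have hY : (S * X * S).PosDef := by
    have h := (Matrix.IsUnit.posDef_star_right_conjugate_iff (x := X) hSu).mpr hX
    rwa [hSs] at h
  have h := norm_det_le_one_of_diag_eq_one hY fun i => by
    rw [hS, Matrix.mul_diagonal, Matrix.diagonal_mul, hdc i]
    have := hrr i
    exact_mod_cast (by linarith : r i * (X i i).re * r i = 1)
  have hSd : ‖S.det‖ = ∏ i, r i := by
    rw [hS, Matrix.det_diagonal, norm_prod]
    exact Finset.prod_congr rfl fun i _ => by simp [abs_of_pos (hr0 i)]
  rw [Matrix.det_mul, Matrix.det_mul, norm_mul, norm_mul, hSd] at h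
  have hP : (∏ i, r i) * (∏ i, r i) * ∏ i, (X i i).re = 1 := by
    rw [← Finset.prod_mul_distrib, ← Finset.prod_mul_distrib]
    exact Finset.prod_eq_one fun i _ => hrr i
  have hpos : 0 < (∏ i, r i) * ∏ i, r i :=
    mul_pos (Finset.prod_pos fun i _ => hr0 i) (Finset.prod_pos fun i _ => hr0 i)
  refine le_of_mul_le_mul_left ?_ hpos
  rw [hP]
  linarith

/-! ### The determinant ratio attains its minimum. -/

theorem isCompact_unitaryGroup (ι : Type*) [Fintype ι] [DecidableEq ι] :
    IsCompact (Matrix.unitaryGroup ι ℂ : Set (Matrix ι ι ℂ)) := by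
  have hc : IsCompact (Set.univ.pi fun _ : ι => Set.univ.pi fun _ : ι =>
      Metric.closedBall (0 : ℂ) 1) :=
    isCompact_univ_pi fun _ => isCompact_univ_pi fun _ => isCompact_closedBall _ _
  refine IsCompact.of_isClosed_subset hc ?_ ?_
  · have : (Matrix.unitaryGroup ι ℂ : Set (Matrix ι ι ℂ)) = {U | U * Uᴴ = 1} := by
      ext U
      exact Matrix.mem_unitaryGroup_iff
    rw [this]
    exact isClosed_eq (continuous_id.mul continuous_id.matrix_conjTranspose) continuous_const
  · intro U hU i _ j _
    simpa using entry_norm_bound_of_unitary hU i j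

/-- The commutative core of operator scaling: eigenvalues along a minimising sequence, whose
Gram-type coefficients `t` converge to a nonzero matrix `t'` with total support, can be replaced by
convergent ones. -/
theorem exists_scaling_of_tendsto {k m : ℕ} {α : Type*} (𝓕 : Ultrafilter α)
    (x : α → Fin k → ℝ) (z : α → Fin m → ℝ) (t : α → Fin k → Fin m → ℝ) (t' : Fin k → Fin m → ℝ)
    (hx : ∀ a i, 0 < x a i) (hz : ∀ a l, 0 < z a l) (ht0 : ∀ a i l, 0 ≤ t a i l)
    (ht : ∀ i l, Tendsto (fun a => t a i l) 𝓕 (𝓝 (t' i l)))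
    (hsum : ∀ a l, ∑ i, x a i * t a i l = z a l)
    (hts : ∀ i l, t' i l ≠ 0 → ∃ σ : Fin k × Fin m ≃ Fin m × Fin k,
      (∃ q, q.1 = i ∧ (σ q).1 = l) ∧ ∀ q, t' q.1 (σ q).1 ≠ 0)
    (hne : ∃ i l, t' i l ≠ 0) {I : ℝ}
    (hI : Tendsto (fun a => (∏ l, z a l) ^ k / (∏ i, x a i) ^ m) 𝓕 (𝓝 I)) :
    ∃ (u : Fin k → ℝ) (ζ : Fin m → ℝ), (∀ l, ∑ i, Real.exp (u i) * t' i l ≤ Real.exp (ζ l)) ∧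
      Real.exp (k * ∑ l, ζ l - m * ∑ i, u i) = I := by
  classical
  have ht'0 : ∀ i l, 0 ≤ t' i l := fun i l =>
    ge_of_tendsto (ht i l) (Eventually.of_forall fun a => ht0 a i l)
  -- A bijection uses each `i` exactly `m` times and each `l` exactly `k` times, so the sum is minus
  -- the logarithm of the determinant ratio, whatever `σ` is.
  have hsumσ : ∀ (σ : Fin k × Fin m ≃ Fin m × Fin k) (u : Fin k → ℝ) (ζ : Fin m → ℝ),
      ∑ q : Fin k × Fin m, (u q.1 - ζ (σ q).1) = m * ∑ i, u i - k * ∑ l, ζ l := by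
    intro σ u ζ
    rw [Finset.sum_sub_distrib, Equiv.sum_comp σ (fun p => ζ p.1)]
    simp only [Fintype.sum_prod_type, Finset.sum_const, Finset.card_univ, Fintype.card_fin,
      nsmul_eq_mul, Finset.mul_sum]
  have hratio : ∀ a, (∏ l, z a l) ^ k / (∏ i, x a i) ^ m =
      Real.exp (-(m * ∑ i, Real.log (x a i) - k * ∑ l, Real.log (z a l))) := by
    intro a
    rw [neg_sub, Real.exp_sub, Real.exp_nat_mul, Real.exp_nat_mul, Real.exp_sum, Real.exp_sum]
    simp only [Real.exp_log (hx a _), Real.exp_log (hz a _)]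
  let E := {p : Fin k × Fin m // t' p.1 p.2 ≠ 0}
  let c : α → E → ℝ := fun a p => Real.log (x a p.1.1) - Real.log (z a p.1.2)
  have hupper : ∀ i l, t' i l ≠ 0 → ∀ᶠ a in (𝓕 : Filter α),
      Real.log (x a i) - Real.log (z a l) ≤ Real.log (2 / t' i l) := by
    intro i l hil
    have hpos : 0 < t' i l := lt_of_le_of_ne (ht'0 i l) hil.symm
    filter_upwards [(ht i l).eventually (lt_mem_nhds (half_lt_self hpos))] with a ha
    rw [← Real.log_div (hx a i).ne' (hz a l).ne']
    refine Real.log_le_log (div_pos (hx a i) (hz a l)) ?_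
    have h1 : x a i * t a i l ≤ z a l := by
      rw [← hsum a l]
      exact Finset.single_le_sum (f := fun i => x a i * t a i l)
        (fun i _ => mul_nonneg (hx a i).le (ht0 a i l)) (Finset.mem_univ i)
    rw [div_le_div_iff₀ (hz a l) hpos]
    nlinarith [hx a i]
  have hupper' : ∀ᶠ a in (𝓕 : Filter α), ∀ i l, t' i l ≠ 0 →
      Real.log (x a i) - Real.log (z a l) ≤ Real.log (2 / t' i l) := by
    simp only [eventually_all]
    exact hupper
  have hI0 : 0 ≤ I := ge_of_tendsto hI (Eventually.of_forall fun a => by rw [hratio]; positivity)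
  -- Total support passes a `σ` through `(i, l)` along the support of `t'`. The sum over `σ` is
  -- bounded below since the ratio is eventually below `I + 1`, and all other summands are bounded
  -- above, so this one is bounded below.
  have hlower : ∀ i l, t' i l ≠ 0 → ∃ K, ∀ᶠ a in (𝓕 : Filter α),
      K ≤ Real.log (x a i) - Real.log (z a l) := by
    intro i l hil
    obtain ⟨σ, ⟨q, rfl, rfl⟩, hσ⟩ := hts i l hil
    refine ⟨-Real.log (I + 1) - ∑ p ∈ Finset.univ.erase q, Real.log (2 / t' p.1 (σ p).1), ?_⟩
    filter_upwards [hupper', hI.eventually (gt_mem_nhds (lt_add_one I))] with a ha hIa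
    have h1 := hsumσ σ (fun i => Real.log (x a i)) (fun l => Real.log (z a l))
    rw [← Finset.add_sum_erase _ _ (Finset.mem_univ q)] at h1
    have h2 : ∑ p ∈ Finset.univ.erase q, (Real.log (x a p.1) - Real.log (z a (σ p).1)) ≤
        ∑ p ∈ Finset.univ.erase q, Real.log (2 / t' p.1 (σ p).1) :=
      Finset.sum_le_sum fun p _ => ha _ _ (hσ p)
    rw [hratio] at hIa
    have h3 := (Real.lt_log_iff_exp_lt (by linarith)).mpr hIa
    linarith
  choose! K hK using hlower
  have hmem : ∀ᶠ a in (𝓕 : Filter α), c a ∈ Set.Icc (fun p : E => K p.1.1 p.1.2)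
      (fun p : E => Real.log (2 / t' p.1.1 p.1.2)) := by
    have h1 : ∀ᶠ a in (𝓕 : Filter α), ∀ p : E, K p.1.1 p.1.2 ≤ c a p := by
      rw [eventually_all]
      exact fun p => hK _ _ p.2
    filter_upwards [hupper', h1] with a ha hb
    exact ⟨fun p => hb p, fun p => ha _ _ p.2⟩
  obtain ⟨c', -, hc'⟩ := (isCompact_Icc (a := fun p : E => K p.1.1 p.1.2)
    (b := fun p : E => Real.log (2 / t' p.1.1 p.1.2))).ultrafilter_le_nhds (𝓕.map c)
      (le_principal_iff.mpr hmem)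
  have hct : Tendsto c 𝓕 (𝓝 c') := hc'
  -- The logarithms themselves may diverge; only their differences on the support converge. The
  -- range of `L` is a finite-dimensional subspace, hence closed, so the limit again has the form `u
  -- i - ζ l`.
  let L : (Fin k → ℝ) × (Fin m → ℝ) →ₗ[ℝ] (E → ℝ) :=
    { toFun := fun w p => w.1 p.1.1 - w.2 p.1.2
      map_add' := fun w w' => by ext p; simp; ring
      map_smul' := fun r w => by ext p; simp; ring }
  have hclosed : IsClosed ((LinearMap.range L : Submodule ℝ (E → ℝ)) : Set (E → ℝ)) :=
    Submodule.closed_of_finiteDimensional _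
  have hcL : c' ∈ ((LinearMap.range L : Submodule ℝ (E → ℝ)) : Set (E → ℝ)) :=
    hclosed.mem_of_tendsto hct (Eventually.of_forall fun a =>
      ⟨(fun i => Real.log (x a i), fun l => Real.log (z a l)), rfl⟩)
  obtain ⟨⟨u, ζ⟩, huζ⟩ := hcL
  have hlim : ∀ i l, t' i l ≠ 0 → Tendsto (fun a => Real.log (x a i) - Real.log (z a l)) 𝓕
      (𝓝 (u i - ζ l)) := by
    intro i l hil
    have h := (tendsto_pi_nhds.mp hct) ⟨(i, l), hil⟩
    rw [← huζ] at h
    exact h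
  refine ⟨u, ζ, fun l => ?_, ?_⟩
  · have h1 : Tendsto (fun a => ∑ i, if t' i l ≠ 0 then
        Real.exp (Real.log (x a i) - Real.log (z a l)) * t a i l else 0) 𝓕
        (𝓝 (∑ i, if t' i l ≠ 0 then Real.exp (u i - ζ l) * t' i l else 0)) := by
      refine tendsto_finsetSum _ fun i _ => ?_
      split_ifs with h
      · exact ((Real.continuous_exp.tendsto _).comp (hlim i l h)).mul (ht i l)
      · exact tendsto_const_nhds
    have h2 : ∑ i, (if t' i l ≠ 0 then Real.exp (u i - ζ l) * t' i l else 0) ≤ 1 := by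
      refine le_of_tendsto h1 (Eventually.of_forall fun a => ?_)
      calc ∑ i, (if t' i l ≠ 0 then
            Real.exp (Real.log (x a i) - Real.log (z a l)) * t a i l else 0)
          ≤ ∑ i, x a i * t a i l / z a l := by
            refine Finset.sum_le_sum fun i _ => ?_
            have hnn : 0 ≤ x a i * t a i l / z a l :=
              div_nonneg (mul_nonneg (hx a i).le (ht0 a i l)) (hz a l).le
            split_ifs
            · rw [Real.exp_sub, Real.exp_log (hx a i), Real.exp_log (hz a l)]
              exact le_of_eq (by ring)
            · exact hnn
        _ = 1 := by rw [← Finset.sum_div, hsum, div_self (hz a l).ne']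
    have h3 : ∑ i, Real.exp (u i) * t' i l = Real.exp (ζ l) *
        ∑ i, (if t' i l ≠ 0 then Real.exp (u i - ζ l) * t' i l else 0) := by
      rw [Finset.mul_sum]
      refine Finset.sum_congr rfl fun i _ => ?_
      split_ifs with h
      · rw [← mul_assoc, ← Real.exp_add, add_sub_cancel]
      · rw [not_not.mp h, mul_zero, mul_zero]
    rw [h3]
    exact mul_le_of_le_one_right (Real.exp_pos _).le h2
  · obtain ⟨i, l, hil⟩ := hne
    obtain ⟨σ, -, hσ⟩ := hts i l hil
    refine tendsto_nhds_unique (f := fun a => (∏ l, z a l) ^ k / (∏ i, x a i) ^ m) ?_ hI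
    have h1 : Tendsto (fun a => Real.exp (-∑ q : Fin k × Fin m,
        (Real.log (x a q.1) - Real.log (z a (σ q).1)))) 𝓕
        (𝓝 (Real.exp (-∑ q : Fin k × Fin m, (u q.1 - ζ (σ q).1)))) :=
      (Real.continuous_exp.tendsto _).comp
        (tendsto_finsetSum _ fun q _ => hlim _ _ (hσ q)).neg
    rw [hsumσ, neg_sub] at h1
    refine h1.congr fun a => ?_
    rw [hratio, hsumσ σ (fun i => Real.log (x a i)) (fun l => Real.log (z a l))]

/-- The columns of a matrix as Euclidean vectors. -/
def colVec {d : ℕ} (U : Matrix (Fin d) (Fin d) ℂ) (i : Fin d) : EuclideanSpace ℂ (Fin d) :=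
  WithLp.toLp 2 fun a => U a i

theorem exists_orthonormalBasis_colVec {d : ℕ} {U : Matrix (Fin d) (Fin d) ℂ}
    (hU : U ∈ Matrix.unitaryGroup (Fin d) ℂ) :
    ∃ v : OrthonormalBasis (Fin d) ℂ (EuclideanSpace ℂ (Fin d)), ∀ i, v i = colVec U i := by
  have hon : Orthonormal ℂ (colVec U) := by
    rw [orthonormal_iff_ite]
    intro i j
    have h := congrFun (congrFun (Matrix.mem_unitaryGroup_iff'.mp hU) i) j
    rw [Matrix.mul_apply, Matrix.one_apply] at h
    rw [← h, EuclideanSpace.inner_eq_star_dotProduct, dotProduct]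
    refine Finset.sum_congr rfl fun a _ => ?_
    simp [colVec, mul_comm]
  obtain ⟨b, hb⟩ := Orthonormal.exists_orthonormalBasis_extension_of_card_eq
    (v := colVec U) (s := Set.univ) (by simp) (hon.comp _ Subtype.val_injective)
  exact ⟨b, fun i => hb i (Set.mem_univ i)⟩

theorem sum_smul_outer_colVec {d : ℕ} (U : Matrix (Fin d) (Fin d) ℂ) (x : Fin d → ℂ) :
    U * diagonal x * Uᴴ = ∑ i, x i • outer (colVec U i) := by
  ext a b
  rw [Matrix.mul_apply]
  simp only [Matrix.mul_diagonal, conjTranspose_apply, Matrix.sum_apply, Matrix.smul_apply, outer, colVec, Matrix.of_apply, smul_eq_mul]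
  exact Finset.sum_congr rfl fun i _ => by ring

theorem trace_mul_outer_colVec {d : ℕ} (X U : Matrix (Fin d) (Fin d) ℂ) (i : Fin d) :
    (X * outer (colVec U i)).trace = (Uᴴ * X * U) i i := by
  rw [trace_mul_outer, Matrix.mul_assoc, Matrix.mul_apply]
  rfl

theorem continuous_outer_colVec {d : ℕ} (i : Fin d) :
    Continuous fun U : Matrix (Fin d) (Fin d) ℂ => outer (colVec U i) := by
  refine continuous_matrix fun a b => ?_
  exact (continuous_id.matrix_elem a i).mul (continuous_id.matrix_elem b i).star

theorem continuous_trace_map_outer {k m : ℕ}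
    (T : Matrix (Fin k) (Fin k) ℂ →ₗ[ℂ] Matrix (Fin m) (Fin m) ℂ) (i : Fin k) (l : Fin m) :
    Continuous fun p : Matrix (Fin k) (Fin k) ℂ × Matrix (Fin m) (Fin m) ℂ =>
      (T (outer (colVec p.1 i)) * outer (colVec p.2 l)).trace.re := by
  have hT : Continuous T := LinearMap.continuous_of_finiteDimensional T
  have h1 : Continuous fun p : Matrix (Fin k) (Fin k) ℂ × Matrix (Fin m) (Fin m) ℂ =>
      T (outer (colVec p.1 i)) := hT.comp ((continuous_outer_colVec i).comp continuous_fst)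
  have h2 : Continuous fun p : Matrix (Fin k) (Fin k) ℂ × Matrix (Fin m) (Fin m) ℂ =>
      outer (colVec p.2 l) := (continuous_outer_colVec l).comp continuous_snd
  exact Complex.continuous_re.comp (h1.matrix_mul h2).matrix_trace

/-- The coefficients `tr (T (p p^*) q q^*)` for `p`, `q` columns of `P`, `Q`. -/
def gram {k m : ℕ} (T : Matrix (Fin k) (Fin k) ℂ →ₗ[ℂ] Matrix (Fin m) (Fin m) ℂ)
    (P : Matrix (Fin k) (Fin k) ℂ) (Q : Matrix (Fin m) (Fin m) ℂ) (i : Fin k) (l : Fin m) : ℝ :=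
  (T (outer (colVec P i)) * outer (colVec Q l)).trace.re

theorem tendsto_gram {k m : ℕ} {α : Type*} {𝓕 : Filter α}
    (T : Matrix (Fin k) (Fin k) ℂ →ₗ[ℂ] Matrix (Fin m) (Fin m) ℂ)
    {U : α → Matrix (Fin k) (Fin k) ℂ} {U' : Matrix (Fin k) (Fin k) ℂ}
    {W : α → Matrix (Fin m) (Fin m) ℂ} {W' : Matrix (Fin m) (Fin m) ℂ}
    (hU : Tendsto U 𝓕 (𝓝 U')) (hW : Tendsto W 𝓕 (𝓝 W')) (i : Fin k) (l : Fin m) :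
    Tendsto (fun n => gram T (U n) (W n) i l) 𝓕 (𝓝 (gram T U' W' i l)) := by
  have hc := continuous_trace_map_outer T i l
  have h1 : Tendsto (fun n => (U n, W n)) 𝓕 (𝓝 (U', W')) := hU.prodMk_nhds hW
  have h2 := hc.tendsto (U', W')
  have h3 := h2.comp h1
  exact h3

-- Diagonalise a minimising sequence and its images, and let the unitaries converge by compactness.
-- The scaling lemma supplies limiting eigenvalues `exp (u i)`; Hadamard's inequality in the
-- limiting basis bounds the determinant of the image by `exp (∑ ζ)`, so the ratio at the new matrix
-- does not exceed the infimum.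
set_option maxHeartbeats 400000 in
theorem exists_min_det_ratio {k m : ℕ} (hm : 0 < m)
    {T : Matrix (Fin k) (Fin k) ℂ →ₗ[ℂ] Matrix (Fin m) (Fin m) ℂ} (hT : IsPositiveMap T)
    (hTp : ∀ X, X.PosDef → (T X).PosDef) (hts : MapTotalSupport T) :
    ∃ X₀ : Matrix (Fin k) (Fin k) ℂ, X₀.PosDef ∧ ∀ X, X.PosDef →
      ‖(T X₀).det‖ ^ k / ‖X₀.det‖ ^ m ≤ ‖(T X).det‖ ^ k / ‖X.det‖ ^ m := by
  classical
  set V : Set ℝ := (fun X : Matrix (Fin k) (Fin k) ℂ => ‖(T X).det‖ ^ k / ‖X.det‖ ^ m) ''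
    {X | X.PosDef} with hV
  have hbdd : BddBelow V := ⟨0, by rintro _ ⟨X, -, rfl⟩; positivity⟩
  have hVne : V.Nonempty := ⟨_, 1, Matrix.PosDef.one, rfl⟩
  obtain ⟨φ, -, hφ, hφV⟩ := exists_seq_tendsto_sInf hVne hbdd
  choose X hXp hXφ using hφV
  choose U hU x hx hXU using fun n => posDef_eq_unitary_conj (hXp n)
  choose W hW z hz hTW using fun n => posDef_eq_unitary_conj (hTp _ (hXp n))
  obtain ⟨𝓕, h𝓕⟩ : ∃ 𝓕 : Ultrafilter ℕ, (𝓕 : Filter ℕ) ≤ atTop :=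
    ⟨Filter.hyperfilter ℕ, Nat.hyperfilter_le_atTop⟩
  obtain ⟨U', hU', hUt⟩ := (isCompact_unitaryGroup (Fin k)).ultrafilter_le_nhds (𝓕.map U)
    (le_principal_iff.mpr (Eventually.of_forall (f := (𝓕 : Filter ℕ)) hU))
  obtain ⟨W', hW', hWt⟩ := (isCompact_unitaryGroup (Fin m)).ultrafilter_le_nhds (𝓕.map W)
    (le_principal_iff.mpr (Eventually.of_forall (f := (𝓕 : Filter ℕ)) hW))
  have hUt : Tendsto U 𝓕 (𝓝 U') := hUt
  have hWt : Tendsto W 𝓕 (𝓝 W') := hWt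
  set τ := gram T with hτ
  have hτnn : ∀ P Q i l, 0 ≤ (T (outer (colVec P i)) * outer (colVec Q l)).trace := by
    intro P Q i l
    rw [trace_mul_outer]
    exact (hT _ (outer_posSemidef _)).dotProduct_mulVec_nonneg _
  have hτc : ∀ P Q i l, (T (outer (colVec P i)) * outer (colVec Q l)).trace = (τ P Q i l : ℂ) :=
    fun P Q i l => Complex.ext rfl (by simpa using (Complex.nonneg_iff.mp (hτnn P Q i l)).2.symm)
  have hτsum : ∀ P Q (y : Fin k → ℝ) l, ((∑ i, y i * τ P Q i l : ℝ) : ℂ) =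
      (Qᴴ * T (P * diagonal (fun i => (y i : ℂ)) * Pᴴ) * Q) l l := by
    intro P Q y l
    rw [← trace_mul_outer_colVec, sum_smul_outer_colVec, map_sum, Finset.sum_mul,
      Matrix.trace_sum]
    push_cast
    refine Finset.sum_congr rfl fun i _ => ?_
    rw [map_smul, Matrix.smul_mul, Matrix.trace_smul, hτc, smul_eq_mul]
  have hτt : ∀ i l, Tendsto (fun n => τ (U n) (W n) i l) 𝓕 (𝓝 (τ U' W' i l)) := tendsto_gram T hUt hWt
  have hsum : ∀ n l, ∑ i, x n i * τ (U n) (W n) i l = z n l := by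
    intro n l
    have h1 := hτsum (U n) (W n) (x n) l
    have hWW : (W n)ᴴ * W n = 1 := Matrix.mem_unitaryGroup_iff'.mp (hW n)
    rw [← hXU, hTW, show (W n)ᴴ * (W n * diagonal (fun i => (z n i : ℂ)) * (W n)ᴴ) * W n =
      ((W n)ᴴ * W n) * diagonal (fun i => (z n i : ℂ)) * ((W n)ᴴ * W n) by
        simp only [Matrix.mul_assoc], hWW, Matrix.one_mul, Matrix.mul_one,
      Matrix.diagonal_apply_eq] at h1
    exact_mod_cast h1
  obtain ⟨v, hv⟩ := exists_orthonormalBasis_colVec hU'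
  obtain ⟨w, hw⟩ := exists_orthonormalBasis_colVec hW'
  have hts' : ∀ i l, τ U' W' i l ≠ 0 → ∃ σ : Fin k × Fin m ≃ Fin m × Fin k,
      (∃ q, q.1 = i ∧ (σ q).1 = l) ∧ ∀ q, τ U' W' q.1 (σ q).1 ≠ 0 := by
    intro i l hil
    -- The second coordinates are arbitrary: the all-ones factor ignores them.
    obtain ⟨σ, h1, h2⟩ := hts v w (i, ⟨0, hm⟩) (l, ⟨i, i.2⟩)
      (by simpa [Matrix.kroneckerMap_apply, hv, hw, hτc] using hil)
    refine ⟨σ, ⟨(i, ⟨0, hm⟩), rfl, by rw [h1]⟩, fun q => ?_⟩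
    have h3 := Finset.prod_ne_zero_iff.mp h2 q (Finset.mem_univ q)
    simpa [Matrix.kroneckerMap_apply, hv, hw, hτc] using h3
  have hpos' : ∀ {y : Fin k → ℝ}, (∀ i, 0 < y i) →
      (W'ᴴ * T (U' * diagonal (fun i => (y i : ℂ)) * U'ᴴ) * W').PosDef := by
    intro y hy
    have hu : IsUnit W' := IsUnit.of_mul_eq_one _ (Matrix.mem_unitaryGroup_iff.mp hW')
    exact (Matrix.IsUnit.posDef_star_left_conjugate_iff hu).mpr
      (hTp _ (unitary_conj_diagonal_posDef hU' hy))
  have hne : ∃ i l, τ U' W' i l ≠ 0 := by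
    by_contra! h
    have h1 := (hpos' (y := fun _ => 1) fun _ => one_pos).diag_pos (i := ⟨0, hm⟩)
    rw [← hτsum] at h1
    simp [h] at h1
  have hratio : ∀ n, φ n = (∏ l, z n l) ^ k / (∏ i, x n i) ^ m := by
    intro n
    rw [← hXφ]
    dsimp only
    rw [hTW, norm_det_unitary_conj_diagonal (hW n) (hz n)]
    conv_lhs => rw [hXU, norm_det_unitary_conj_diagonal (hU n) (hx n)]
  obtain ⟨u, ζ, h1, h2⟩ := exists_scaling_of_tendsto 𝓕 x z (fun n => τ (U n) (W n)) (τ U' W') hx hz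
    (fun n i l => (Complex.nonneg_iff.mp (hτnn _ _ i l)).1) hτt hsum hts' hne
    (I := sInf V) ((hφ.mono_left h𝓕).congr hratio)
  have hexp : ∀ i, 0 < Real.exp (u i) := fun i => Real.exp_pos _
  refine ⟨U' * diagonal (fun i => (Real.exp (u i) : ℂ)) * U'ᴴ, ?_, fun Y hY => ?_⟩
  · exact_mod_cast unitary_conj_diagonal_posDef hU' hexp
  · refine le_trans ?_ (csInf_le hbdd ⟨Y, hY, rfl⟩)
    rw [← h2, norm_det_unitary_conj_diagonal hU' hexp]
    have h3 := norm_det_le_prod_diag (hpos' hexp)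
    have h4 : ‖(W'ᴴ * T (U' * diagonal (fun i => (Real.exp (u i) : ℂ)) * U'ᴴ) * W').det‖ =
        ‖(T (U' * diagonal (fun i => (Real.exp (u i) : ℂ)) * U'ᴴ)).det‖ := by
      have hWs : W'ᴴ ∈ Matrix.unitaryGroup (Fin m) ℂ :=
        Unitary.star_mem hW'
      have := det_unitary_conj hWs (T (U' * diagonal (fun i => (Real.exp (u i) : ℂ)) * U'ᴴ))
      rw [Matrix.conjTranspose_conjTranspose] at this
      rw [this]
    have h5 : ∏ l, ((W'ᴴ * T (U' * diagonal (fun i => (Real.exp (u i) : ℂ)) * U'ᴴ) * W') l l).re ≤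
        Real.exp (∑ l, ζ l) := by
      rw [Real.exp_sum]
      refine Finset.prod_le_prod (fun l _ => ?_) fun l _ => ?_
      · exact (Complex.pos_iff.mp ((hpos' hexp).diag_pos (i := l))).1.le
      · rw [← hτsum U' W' (fun i => Real.exp (u i)) l, Complex.ofReal_re]
        exact h1 l
    rw [h4] at h3
    rw [Real.exp_sub, Real.exp_nat_mul, Real.exp_nat_mul, Real.exp_sum Finset.univ u]
    gcongr
    exact h3.trans h5

/-! ### The first-order condition at a minimiser. -/

theorem isHermitian_eq_sum_outer {d : ℕ} {X : Matrix (Fin d) (Fin d) ℂ} (hX : X.IsHermitian) :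
    ∃ (x : Fin d → ℂ) (v : Fin d → EuclideanSpace ℂ (Fin d)), X = ∑ i, x i • outer (v i) := by
  have h := hX.spectral_theorem
  rw [Unitary.conjStarAlgAut_apply] at h
  exact ⟨_, _, h.trans (sum_smul_outer_colVec _ _)⟩

theorem linearMap_eq_of_outer {d : ℕ} {f g : Matrix (Fin d) (Fin d) ℂ →ₗ[ℂ] ℂ}
    (h : ∀ v : EuclideanSpace ℂ (Fin d), f (outer v) = g (outer v)) : f = g := by
  have herm : ∀ X : Matrix (Fin d) (Fin d) ℂ, X.IsHermitian → f X = g X := by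
    intro X hX
    obtain ⟨x, v, rfl⟩ := isHermitian_eq_sum_outer hX
    simp [h]
  refine LinearMap.ext fun Z => ?_
  rw [← realPart_add_I_smul_imaginaryPart Z, map_add, map_add, map_smul, map_smul,
    herm _ (realPart Z).2, herm _ (imaginaryPart Z).2]

theorem posDef_eq_mul_conjTranspose {ι : Type*} [Fintype ι] [DecidableEq ι] {X : Matrix ι ι ℂ}
    (hX : X.PosDef) : ∃ P, IsUnit P ∧ X = P * Pᴴ := by
  open scoped MatrixOrder in
  obtain ⟨P, hP⟩ := CStarAlgebra.nonneg_iff_eq_mul_star_self.mp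
    (Matrix.nonneg_iff_posSemidef.mpr hX.posSemidef)
  refine ⟨P, ?_, hP⟩
  have h := hX.isUnit
  rw [Matrix.isUnit_iff_isUnit_det] at h ⊢
  rw [hP, Matrix.det_mul] at h
  exact isUnit_of_mul_isUnit_left h

/-- With `x i₀` the least eigenvalue, `X - x i₀ • 1` is positive semidefinite, so `T X` dominates
the positive definite `x i₀ • T 1`. -/
theorem posDef_map {k m : ℕ} {T : Matrix (Fin k) (Fin k) ℂ →ₗ[ℂ] Matrix (Fin m) (Fin m) ℂ}
    (hk : 0 < k) (hT : IsPositiveMap T) (h1 : (T 1).PosDef) {X : Matrix (Fin k) (Fin k) ℂ}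
    (hX : X.PosDef) : (T X).PosDef := by
  obtain ⟨U, hU, x, hx, rfl⟩ := posDef_eq_unitary_conj hX
  have : Nonempty (Fin k) := ⟨⟨0, hk⟩⟩
  obtain ⟨i₀, hi₀⟩ := Finite.exists_min x
  have hUU : U * Uᴴ = 1 := Matrix.mem_unitaryGroup_iff.mp hU
  have hsplit : U * diagonal (fun i => (x i : ℂ)) * Uᴴ =
      U * diagonal (fun i => ((x i - x i₀ : ℝ) : ℂ)) * Uᴴ + (x i₀ : ℂ) • 1 := by
    have hd : diagonal (fun i => (x i : ℂ)) =
        diagonal (fun i => ((x i - x i₀ : ℝ) : ℂ)) + (x i₀ : ℂ) • 1 := by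
      rw [← Matrix.diagonal_one, ← Matrix.diagonal_smul, Matrix.diagonal_add]
      congr 1
      ext i
      simp
    rw [hd, Matrix.mul_add, Matrix.add_mul, Matrix.mul_smul, Matrix.mul_one, Matrix.smul_mul, hUU]
  rw [hsplit, map_add, map_smul]
  refine Matrix.PosDef.posSemidef_add (hT _ ?_) (h1.smul (by exact_mod_cast hx i₀))
  refine Matrix.PosSemidef.mul_mul_conjTranspose_same (Matrix.PosSemidef.diagonal fun i => ?_) U
  have := hi₀ i
  simpa using this

theorem eventually_posDef_one_add_smul {ι : Type*} [Fintype ι] [DecidableEq ι] {H : Matrix ι ι ℂ}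
    (hH : H.IsHermitian) : ∀ᶠ s : ℝ in 𝓝 0, (1 + (s : ℂ) • H).PosDef := by
  have h := hH.spectral_theorem
  rw [Unitary.conjStarAlgAut_apply] at h
  set U : Matrix ι ι ℂ := ↑hH.eigenvectorUnitary with hU
  have hUm : U ∈ Matrix.unitaryGroup ι ℂ := SetLike.coe_mem _
  have hUU : U * Uᴴ = 1 := Matrix.mem_unitaryGroup_iff.mp hUm
  have hev : ∀ᶠ s : ℝ in 𝓝 0, ∀ i, 0 < 1 + s * hH.eigenvalues i := by
    rw [eventually_all]
    intro i
    have hc : Continuous fun s : ℝ => 1 + s * hH.eigenvalues i := by fun_prop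
    exact hc.continuousAt.eventually (lt_mem_nhds (by simp))
  filter_upwards [hev] with s hs
  convert unitary_conj_diagonal_posDef hUm hs using 1
  have hd : diagonal (fun i => ((1 + s * hH.eigenvalues i : ℝ) : ℂ)) =
      1 + (s : ℂ) • diagonal (RCLike.ofReal ∘ hH.eigenvalues) := by
    rw [← Matrix.diagonal_one, ← Matrix.diagonal_smul, Matrix.diagonal_add]
    congr 1
    ext i
    simp
  rw [hd, Matrix.mul_add, Matrix.add_mul, Matrix.mul_smul, Matrix.mul_one, Matrix.smul_mul, hUU]
  conv_lhs => rw [h]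
  rfl

theorem hasDerivAt_det_one_add_smul {ι : Type*} [Fintype ι] [DecidableEq ι] (H : Matrix ι ι ℂ) :
    HasDerivAt (fun s : ℝ => ((1 + (s : ℂ) • H).det).re) H.trace.re 0 := by
  obtain ⟨p, hp⟩ : ∃ p : Polynomial ℂ, ∀ r : ℂ,
      (1 + r • H).det = 1 + H.trace * r + p.eval r * r ^ 2 := ⟨_, fun r => Matrix.det_one_add_smul r H⟩
  have h1 : HasDerivAt (fun r : ℂ => 1 + H.trace * r + p.eval r * r ^ 2) H.trace ((0 : ℝ) : ℂ) := by
    have ha := ((hasDerivAt_id ((0 : ℝ) : ℂ)).const_mul H.trace).const_add 1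
    have hb := (p.hasDerivAt ((0 : ℝ) : ℂ)).mul (hasDerivAt_pow 2 ((0 : ℝ) : ℂ))
    refine (ha.add hb).congr_deriv ?_
    simp
  simp only [hp]
  exact h1.real_of_complex

theorem norm_det_eq_re_of_posDef {ι : Type*} [Fintype ι] [DecidableEq ι] {X : Matrix ι ι ℂ}
    (hX : X.PosDef) : ‖X.det‖ = X.det.re := by
  rw [← Complex.re_eq_norm.mpr hX.det_pos.le]

theorem trace_eq_of_norm_det_pow_le {k m : ℕ}
    {T : Matrix (Fin k) (Fin k) ℂ →ₗ[ℂ] Matrix (Fin m) (Fin m) ℂ} (hT : IsPositiveMap T)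
    (hTp : ∀ X, X.PosDef → (T X).PosDef) (h1 : T 1 = 1)
    (hdet : ∀ X, X.PosDef → ‖X.det‖ ^ m ≤ ‖(T X).det‖ ^ k) (Z : Matrix (Fin k) (Fin k) ℂ) :
    (k : ℂ) * (T Z).trace = m * Z.trace := by
  have houter : ∀ v : EuclideanSpace ℂ (Fin k),
      (k : ℂ) * (T (outer v)).trace = m * (outer v).trace := by
    intro v
    set H := outer v with hH
    have hHp : H.PosSemidef := outer_posSemidef v
    have hd := ((hasDerivAt_det_one_add_smul (T H)).pow k).sub
      ((hasDerivAt_det_one_add_smul H).pow m)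
    -- The difference vanishes at `s = 0` because `T 1 = 1`, and is nonnegative nearby by `hdet`.
    have hmin : IsLocalMin ((fun s : ℝ => ((1 + (s : ℂ) • T H).det).re) ^ k -
        (fun s : ℝ => ((1 + (s : ℂ) • H).det).re) ^ m) 0 := by
      filter_upwards [eventually_posDef_one_add_smul hHp.isHermitian] with s hs
      have h := hdet _ hs
      have hs' := hTp _ hs
      rw [norm_det_eq_re_of_posDef hs, norm_det_eq_re_of_posDef hs'] at h
      rw [map_add, h1, map_smul] at h
      simpa using h
    have h0 := hmin.hasDerivAt_eq_zero hd
    have hre : (k : ℝ) * (T H).trace.re = m * H.trace.re := by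
      simp at h0
      linarith
    have hr1 := (Complex.nonneg_iff.mp (hT _ hHp).trace_nonneg).2
    have hr2 := (Complex.nonneg_iff.mp hHp.trace_nonneg).2
    refine Complex.ext ?_ ?_
    · simpa using hre
    · simp [← hr1, ← hr2]
  have h := linearMap_eq_of_outer
    (f := (k : ℂ) • (Matrix.traceLinearMap (Fin m) ℂ ℂ ∘ₗ T))
    (g := (m : ℂ) • Matrix.traceLinearMap (Fin k) ℂ ℂ) (fun v => by simpa using houter v)
  simpa using LinearMap.congr_fun h Z

/-- The map `Z ↦ S * T (P * Z * Pᴴ) * Sᴴ`. -/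
def conjMap {k m : ℕ} (T : Matrix (Fin k) (Fin k) ℂ →ₗ[ℂ] Matrix (Fin m) (Fin m) ℂ)
    (P : Matrix (Fin k) (Fin k) ℂ) (S : Matrix (Fin m) (Fin m) ℂ) :
    Matrix (Fin k) (Fin k) ℂ →ₗ[ℂ] Matrix (Fin m) (Fin m) ℂ where
  toFun Z := S * T (P * Z * Pᴴ) * Sᴴ
  map_add' X Y := by simp [Matrix.mul_add, Matrix.add_mul]
  map_smul' c X := by simp

theorem conjMap_apply {k m : ℕ} (T : Matrix (Fin k) (Fin k) ℂ →ₗ[ℂ] Matrix (Fin m) (Fin m) ℂ)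
    (P Z : Matrix (Fin k) (Fin k) ℂ) (S : Matrix (Fin m) (Fin m) ℂ) :
    conjMap T P S Z = S * T (P * Z * Pᴴ) * Sᴴ := rfl

/-! ### Operator scaling and the converse direction. -/

/-- Operator scaling: a positive map with total support, sending positive definite matrices to
positive definite ones, is equivalent to a doubly stochastic map. -/
theorem exists_doublyStochastic_scaling {k m : ℕ} (hm : 0 < m)
    {T : Matrix (Fin k) (Fin k) ℂ →ₗ[ℂ] Matrix (Fin m) (Fin m) ℂ} (hT : IsPositiveMap T)
    (hTp : ∀ X, X.PosDef → (T X).PosDef) (hts : MapTotalSupport T) :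
    ∃ (P : Matrix (Fin k) (Fin k) ℂ) (S : Matrix (Fin m) (Fin m) ℂ), IsUnit P ∧ IsUnit S ∧
      conjMap T P S 1 = 1 ∧ ∀ Z, (k : ℂ) * (conjMap T P S Z).trace = m * Z.trace := by
  obtain ⟨X₀, hX₀, hmin⟩ := exists_min_det_ratio hm hT hTp hts
  obtain ⟨P, hP, hPX⟩ := posDef_eq_mul_conjTranspose hX₀
  obtain ⟨Q, hQ, hQX⟩ := posDef_eq_mul_conjTranspose (hTp _ hX₀)
  have hQd : IsUnit Q.det := (Matrix.isUnit_iff_isUnit_det _).mp hQ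
  have hPd : IsUnit P.det := (Matrix.isUnit_iff_isUnit_det _).mp hP
  have hS : IsUnit Q⁻¹ := (Matrix.isUnit_nonsing_inv_iff).mpr hQ
  -- With `X₀ = P Pᴴ` and `T X₀ = Q Qᴴ`, conjugating by `P` inside and `Q⁻¹` outside moves the
  -- minimiser and its image to the identity.
  have h1 : conjMap T P Q⁻¹ 1 = 1 := by
    rw [conjMap_apply, Matrix.mul_one, ← hPX, hQX, ← Matrix.mul_assoc,
      Matrix.nonsing_inv_mul _ hQd, Matrix.one_mul, ← Matrix.conjTranspose_mul,
      Matrix.nonsing_inv_mul _ hQd, Matrix.conjTranspose_one]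
  have hPp : ∀ X : Matrix (Fin k) (Fin k) ℂ, X.PosDef → (P * X * Pᴴ).PosDef := fun X hX =>
    (Matrix.IsUnit.posDef_star_right_conjugate_iff hP).mpr hX
  refine ⟨P, Q⁻¹, hP, hS, h1, trace_eq_of_norm_det_pow_le
    (fun X hX => (hT _ (hX.mul_mul_conjTranspose_same P)).mul_mul_conjTranspose_same _)
    (fun X hX => (Matrix.IsUnit.posDef_star_right_conjugate_iff hS).mpr (hTp _ (hPp X hX))) h1 ?_⟩
  intro X hX
  have h := hmin _ (hPp X hX)
  have hp : 0 < ‖P.det‖ := norm_pos_iff.mpr hPd.ne_zero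
  have hq : 0 < ‖Q.det‖ := norm_pos_iff.mpr hQd.ne_zero
  have hx : 0 < ‖X.det‖ := norm_pos_iff.mpr hX.det_pos.ne'
  have hdQ : ‖(T X₀).det‖ = ‖Q.det‖ * ‖Q.det‖ := by
    rw [hQX, Matrix.det_mul, Matrix.det_conjTranspose, norm_mul, norm_star]
  have hdP : ‖X₀.det‖ = ‖P.det‖ * ‖P.det‖ := by
    rw [hPX, Matrix.det_mul, Matrix.det_conjTranspose, norm_mul, norm_star]
  have hdX : ‖(P * X * Pᴴ).det‖ = ‖P.det‖ * ‖P.det‖ * ‖X.det‖ := by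
    rw [Matrix.det_mul, Matrix.det_mul, Matrix.det_conjTranspose, norm_mul, norm_mul, norm_star]
    ring
  have hdT : ‖(conjMap T P Q⁻¹ X).det‖ * (‖Q.det‖ * ‖Q.det‖) = ‖(T (P * X * Pᴴ)).det‖ := by
    have : Q.det⁻¹ = (Q⁻¹).det := by rw [Matrix.det_nonsing_inv, Ring.inverse_eq_inv']
    rw [conjMap_apply, Matrix.det_mul, Matrix.det_mul, Matrix.det_conjTranspose, norm_mul, norm_mul,
      norm_star, ← this, norm_inv]
    field_simp
  rw [← hdT, hdX, hdQ, hdP, mul_pow _ (‖Q.det‖ * ‖Q.det‖), mul_pow _ ‖X.det‖,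
    div_le_div_iff₀ (by positivity) (by positivity)] at h
  have hpos : 0 < (‖Q.det‖ * ‖Q.det‖) ^ k * (‖P.det‖ * ‖P.det‖) ^ m := by positivity
  refine le_of_mul_le_mul_left ?_ hpos
  linarith

theorem canBePutInFilterNormalForm_of_totalSupport {n k m : ℕ} (hk : 0 < k) (hm : 0 < m)
    {A : Fin n → Matrix (Fin k) (Fin k) ℂ} {B : Fin n → Matrix (Fin m) (Fin m) ℂ}
    (hA : (∑ i, A i ⊗ₖ B i).PosSemidef) (hG : (mapG A B 1).PosDef)
    (h : ∃ T : Matrix (Fin k) (Fin k) ℂ →ₗ[ℂ] Matrix (Fin m) (Fin m) ℂ,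
      IsPositiveMap T ∧ EquivalentMaps (mapG A B) T ∧ MapTotalSupport T) :
    CanBePutInFilterNormalForm n (∑ i, A i ⊗ₖ B i) := by
  obtain ⟨T, hT, ⟨X, Y, hX, hY, hXY⟩, hts⟩ := h
  have hTp : ∀ Z, Z.PosDef → (T Z).PosDef := fun Z hZ => by
    rw [hXY]
    exact (Matrix.IsUnit.posDef_star_right_conjugate_iff hY).mpr
      (posDef_map hk (mapG_isPositiveMap hA) hG
        ((Matrix.IsUnit.posDef_star_right_conjugate_iff hX).mpr hZ))
  obtain ⟨P, S, hP, hS, h1, htr⟩ := exists_doublyStochastic_scaling hm hT hTp hts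
  have hk0 : 0 < Real.sqrt k := Real.sqrt_pos.mpr (Nat.cast_pos.mpr hk)
  have hm0 : 0 < Real.sqrt m := Real.sqrt_pos.mpr (Nat.cast_pos.mpr hm)
  -- The scalar enters the map squared, through `X'` and its adjoint; its square is the factor
  -- `√k/√m` that the normal form requires.
  set c : ℝ := Real.sqrt (Real.sqrt k / Real.sqrt m) with hc
  have hc0 : 0 < c := Real.sqrt_pos.mpr (div_pos hk0 hm0)
  have hcc : (c : ℂ) * c = ((Real.sqrt k / Real.sqrt m : ℝ) : ℂ) := by
    rw [← Complex.ofReal_mul, Real.mul_self_sqrt (div_pos hk0 hm0).le]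
  have hcu : IsUnit (c : ℂ) := isUnit_iff_ne_zero.mpr (by exact_mod_cast hc0.ne')
  have hmap : ∀ Z, mapG (fun i => ((c : ℂ) • (X * P)ᴴ) * A i * ((c : ℂ) • (X * P)ᴴ)ᴴ)
      (fun i => (S * Y) * B i * (S * Y)ᴴ) Z =
        ((Real.sqrt k / Real.sqrt m : ℝ) : ℂ) • conjMap T P S Z := by
    intro Z
    rw [mapG_conj, conjMap_apply, hXY, ← hcc]
    simp only [Matrix.conjTranspose_smul, Matrix.conjTranspose_mul,
      Matrix.conjTranspose_conjTranspose, Matrix.smul_mul, Matrix.mul_smul, map_smul, smul_smul,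
      Matrix.mul_assoc, Complex.star_def, Complex.conj_ofReal]
  refine ⟨(c : ℂ) • (X * P)ᴴ, S * Y, ?_, hS.mul hY, ?_⟩
  · have hXP : IsUnit ((X * P)ᴴ) := by
      rw [← Matrix.star_eq_conjTranspose]; exact (hX.mul hP).star
    rw [Matrix.isUnit_iff_isUnit_det] at hXP ⊢
    rw [Matrix.det_smul]
    exact (hcu.pow _).mul hXP
  · have hherm := (hA.mul_mul_conjTranspose_same (((c : ℂ) • (X * P)ᴴ) ⊗ₖ (S * Y))).isHermitian
    rw [kronecker_conj_sum] at hherm ⊢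
    refine isFilterNormalForm_of_doublyStochastic hk hm hherm ?_ fun Z => ?_
    · rw [hmap, h1]
    · have hk2 : ((Real.sqrt k : ℝ) : ℂ) * (Real.sqrt k : ℝ) = k := by
        rw [← Complex.ofReal_mul, Real.mul_self_sqrt (Nat.cast_nonneg k)]; simp
      have hm2 : ((Real.sqrt m : ℝ) : ℂ) * (Real.sqrt m : ℝ) = m := by
        rw [← Complex.ofReal_mul, Real.mul_self_sqrt (Nat.cast_nonneg m)]; simp
      have hkr : ((Real.sqrt k : ℝ) : ℂ) ≠ 0 := by exact_mod_cast hk0.ne'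
      have hmr : ((Real.sqrt m : ℝ) : ℂ) ≠ 0 := by exact_mod_cast hm0.ne'
      have h := htr Z
      rw [← hk2, ← hm2] at h
      rw [hmap, Matrix.trace_smul, smul_eq_mul]
      push_cast
      field_simp
      linear_combination h

end FilterNormalForm

theorem theorem4p1 {k m n : ℕ} (hk : 0 < k) (hm : 0 < m)
    (A : Fin n → Matrix (Fin k) (Fin k) ℂ) (B : Fin n → Matrix (Fin m) (Fin m) ℂ)
    (hA : (∑ i, A i ⊗ₖ B i).PosSemidef)
    (hG : (FilterNormalForm.mapG A B 1).PosDef)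
    (hF : (FilterNormalForm.mapF A B 1).PosDef) :
    (FilterNormalForm.CanBePutInFilterNormalForm n (∑ i, A i ⊗ₖ B i) ↔
      ∃ T : Matrix (Fin k) (Fin k) ℂ →ₗ[ℂ] Matrix (Fin m) (Fin m) ℂ,
        FilterNormalForm.IsPositiveMap T ∧
        FilterNormalForm.EquivalentMaps (FilterNormalForm.mapG A B) T ∧
        FilterNormalForm.MapTotalSupport T) ∧
    ((∃ N : ℕ, FilterNormalForm.CanBePutInFilterNormalForm N (∑ i, A i ⊗ₖ B i)) ↔
      ∃ T : Matrix (Fin k) (Fin k) ℂ →ₗ[ℂ] Matrix (Fin m) (Fin m) ℂ,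
        FilterNormalForm.IsPositiveMap T ∧
        FilterNormalForm.EquivalentMaps (FilterNormalForm.mapG A B) T ∧
        FilterNormalForm.MapTotalSupport T) :=
  ⟨⟨FilterNormalForm.exists_totalSupport_of_filterNormalForm hk hm hA,
      FilterNormalForm.canBePutInFilterNormalForm_of_totalSupport hk hm hA hG⟩,
    ⟨fun ⟨_, h⟩ => FilterNormalForm.exists_totalSupport_of_filterNormalForm hk hm hA h,
      fun h => ⟨n, FilterNormalForm.canBePutInFilterNormalForm_of_totalSupport hk hm hA hG h⟩⟩⟩
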